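/- **Setting.** A *triad* on $\mathbb R^n$ is a triple $(X,Y,Z)$ of real $n\times n$ matrices with $[X,Y]=Z$, $[Z,X]=2X$, $[Z,Y]=-2Y$. For a matrix $M$ put $\mathcal D_M f(\mathbf x)=f'(\mathbf x)M\mathbf x$, and let $\mathcal X=\mathcal D_Y$, $\mathcal Y=\mathcal D_X$, $\mathcal Z=\mathcal D_Z$ act on $\mathbb R[[\mathbf x]]$; the algebra of invariants is $\mathcal J=\ker\mathcal X\subset\mathbb R[[\mathbf x]]$. A *homogeneous weight invariant* is a nonzero homogeneous polynomial $f\in\mathcal J$ with $\mathcal Zf=\widehat f f$ for a scalar $\widehat f$, its *weight* (necessarily a nonnegative integer). A *Hilbert basis* for $\mathcal J$ is a finite ordered set $\alpha=(\alpha_1,\dots,\alpha_p)$ of distinct homogeneous weight invariants such that every element of $\mathcal J\cap\mathbb R[\mathbf x]$ is a polynomial in $\alpha$. A set $A\subset\mathbb N^p$ (identified with the set of monomials $\alpha^{\mathbf k}$, $\mathbf k\in A$) is a *preferred set* with respect to $\alpha$ if the family $(\alpha^{\mathbf k})_{\mathbf k\in A}$ is a formal vector space basis for $\mathcal J$: it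 is linearly independent and every $f\in\mathcal J$ is a (possibly infinite) formal linear combination of it, in which each coefficient of $f$ receives only finitely many nonzero contributions. It is *standard* if $\{\mathbf t^{\mathbf k}:\mathbf k\in A\}$ is the set of monomials not contained in some monomial ideal of $\mathbb R[t_1,\dots,t_p]$. Let $(\acute X,\acute Y,\acute Z)$ on $\mathbb R^n$ (variable $\mathbf x$) and $(\grave X,\grave Y,\grave Z)$ on $\mathbb R^m$ (variable $\mathbf y$, independent of $\mathbf x$) be triads, with Hilbert bases $\alpha=(\alpha_1,\dots,\alpha_p)$, $\beta=(\beta_1,\dots,\beta_q)$ for their algebras of invariants and standard preferred sets $\acute A\subset\mathbb N^p$, $\grave A\subset\mathbb N^q$ with respect to them. Let $(X,Y,Z)$ be the block-diagonal triad on $\mathbb R^{n+m}$ formed from the two triads, and $\mathcal J=\ker\mathcal D_Y\subset\mathbb R[[\mathbf x,\mathbf y]]$. For $f=\alpha^{\mathbf k}$, $g=\beta^{\boldsymbol\ell}$, of weights $\widehat f=\sum_i\widehat\alpha_ik_i$ and $\widehat g=\sum_j\widehat\beta_j\ell_j$, and $0\le s\le\min(\widehat f,\widehat g)$, the *transvectant*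 is $$[\mathbf k;\boldsymbol\ell;s]=(f,g)^{(s)}=\sum_{j=0}^s(-1)^j\binom sj\frac{(\widehat f-j)!}{(\widehat f-s)!}\,\frac{(\widehat g-s+j)!}{(\widehat g-s)!}\,(\mathcal D_{\acute X}^{\,j}f)(\mathcal D_{\grave X}^{\,s-j}g)\in\mathbb R[\mathbf x,\mathbf y].$$ Let $\mathcal C\subset\mathbb N^{p+q+1}$ be the monoid of all $(\mathbf k;\boldsymbol\ell;s)$ with $s\le\sum_i\widehat\alpha_ik_i$ and $s\le\sum_j\widehat\beta_j\ell_j$, let $\mathcal C^*$ be the set of those $(\mathbf k;\boldsymbol\ell;s)\in\mathcal C$ with $\mathbf k\in\acute A$ and $\boldsymbol\ell\in\grave A$ (their transvectants are called *admissible*), and let $\Pi^*$ be the set of *admissible primes*: the nonzero elements of $\mathcal C^*$ that are not a sum of two nonzero elements of $\mathcal C$. For an enumeration $\Pi^*=\{\pi_1,\dots,\pi_t\}$ without repetition put $\vartheta_i=[\pi_i]$; the tuple $\vartheta=(\vartheta_1,\dots,\vartheta_t)$ is called a *factoring order*. A *preferred factorization* of an admissible transvectant $[v]$, $v\in\mathcal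 C^*$, is a monomial $\vartheta^{\mathbf K}$, $\mathbf K\in\mathbb N^t$, with $v=\sum_iK_i\pi_i$ such that for each $j=1,\dots,t$ the number $K_j$ is the largest $c\in\mathbb N$ with $v-\sum_{i<j}K_i\pi_i-c\,\pi_j\in\mathcal C$ (factor out $\vartheta_1$ as often as possible, then $\vartheta_2$ as often as possible from what remains, and so on). The *box product* $A=\acute A\boxtimes_\vartheta\grave A\subset\mathbb N^t$ is the set of the exponents $\mathbf K$ of all preferred factorizations of all admissible transvectants. **Theorem 11.9.** The set $\Pi^*$ is finite. For every factoring order $\vartheta$, the tuple $\vartheta$ is a Hilbert basis for $\mathcal J$, and the box product $A=\acute A\boxtimes_\vartheta\grave A$ is a standard preferred set with respect to $\vartheta$. In particular $A$ is closed under divisors (if $\mathbf K\in A$ and $\mathbf K'\le\mathbf K$ componentwise, then $\mathbf K'\in A$), and $(X,Y,Z)$, $\vartheta$, $A$ are again valid input data for a box product. -/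

import Mathlib

noncomputable section

namespace BoxProduct

open scoped Nat

/-- `(X, Y, Z)` is an `sl₂` triad of real matrices. The zero triad is allowed. -/
structure IsTriad {ι : Type*} [Fintype ι] (X Y Z : Matrix ι ι ℝ) : Prop where
  bracket_X_Y : X * Y - Y * X = Z
  bracket_Z_X : Z * X - X * Z = (2 : ℝ) • X
  bracket_Z_Y : Z * Y - Y * Z = (-2 : ℝ) • Y

/-- The directional derivative `f ↦ f'(x) A x` on the polynomial ring `ℝ[x]`. -/
def polyD {ι : Type*} [Fintype ι] (A : Matrix ι ι ℝ) :
    Derivation ℝ (MvPolynomial ι ℝ) (MvPolynomial ι ℝ) :=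
  ∑ i, (∑ j, A i j • (MvPolynomial.X j : MvPolynomial ι ℝ)) • MvPolynomial.pderiv i

/-- The directional derivative `f ↦ f'(x) A x` on the ring `ℝ[[x]]` of formal power series. -/
def formalD {ι : Type*} [Fintype ι] (A : Matrix ι ι ℝ) :
    Derivation ℝ (MvPowerSeries ι ℝ) (MvPowerSeries ι ℝ) :=
  ∑ i, (∑ j, A i j • (MvPowerSeries.X j : MvPowerSeries ι ℝ)) • MvPowerSeries.pderiv ℝ i

/-- The algebra `𝒥 = ker 𝒳 ⊆ ℝ[[x]]`, `𝒳 = 𝒟_Y`, of formal invariants (as a set). -/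
def formalInvariants {ι : Type*} [Fintype ι] (Y : Matrix ι ι ℝ) : Set (MvPowerSeries ι ℝ) :=
  {f | formalD Y f = 0}

/-- The polynomial invariants `𝒥 ∩ ℝ[x]` (as a set). -/
def polyInvariants {ι : Type*} [Fintype ι] (Y : Matrix ι ι ℝ) : Set (MvPolynomial ι ℝ) :=
  {f | polyD Y f = 0}

/-- A homogeneous weight invariant: a homogeneous polynomial in `ker 𝒳` that is an eigenvector
of `𝒵 = 𝒟_Z`. -/
structure IsHomogeneousWeightInvariant {ι : Type*} [Fintype ι] (Y Z : Matrix ι ι ℝ)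
    (f : MvPolynomial ι ℝ) : Prop where
  ne_zero : f ≠ 0
  homogeneous : ∃ d : ℕ, f.IsHomogeneous d
  invariant : f ∈ polyInvariants Y
  eigenvector : ∃ w : ℝ, polyD Z f = w • f

/-- The weight of `f`: the `w` with `𝒵 f = w f`. Weights of weight invariants are nonnegative
integers, so a natural number suffices; the set below is then `{w}`. -/
def weight {ι : Type*} [Fintype ι] (Z : Matrix ι ι ℝ) (f : MvPolynomial ι ℝ) : ℕ :=
  sInf {w : ℕ | polyD Z f = (w : ℝ) • f}

/-- The monomial `α ^ k = α₁ ^ k₁ ⋯ αₚ ^ kₚ`, as an element of the ring containing the `αᵢ`. -/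
def mon {R : Type*} [CommMonoid R] {p : ℕ} (α : Fin p → R) (k : Fin p →₀ ℕ) : R :=
  ∏ i, α i ^ k i

/-- `α = (α₁, …, αₚ)` is a Hilbert basis for the invariants of the triad: a finite ordered set of
homogeneous weight invariants such that every polynomial invariant is a polynomial in `α`. -/
structure IsHilbertBasis {ι : Type*} [Fintype ι] (Y Z : Matrix ι ι ℝ) {p : ℕ}
    (α : Fin p → MvPolynomial ι ℝ) : Prop where
  injective : Function.Injective α
  weightInvariant : ∀ i, IsHomogeneousWeightInvariant Y Z (α i)
  generates : ∀ f ∈ polyInvariants Y, ∃ P : MvPolynomial (Fin p) ℝ, MvPolynomial.aeval α P = f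

/-- `f = ∑ c_k e_k` as a formal sum in `ℝ[[x]]`: each coefficient receives only finitely many
nonzero contributions, and these add up to the coefficient of `f`. -/
def IsFormalSum {ι K : Type*} (c : K → ℝ) (e : K → MvPolynomial ι ℝ) (f : MvPowerSeries ι ℝ) :
    Prop :=
  ∀ m : ι →₀ ℕ, {k | c k * (e k).coeff m ≠ 0}.Finite ∧
    MvPowerSeries.coeff m f = ∑ᶠ k, c k * (e k).coeff m

/-- The set `A` of exponents is a preferred set with respect to `α`: the monomials `α ^ k`,
`k ∈ A`, form a formal vector space basis for `𝒥`. -/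
structure IsPreferredSet {ι : Type*} [Fintype ι] (Y : Matrix ι ι ℝ) {p : ℕ}
    (α : Fin p → MvPolynomial ι ℝ) (A : Set (Fin p →₀ ℕ)) : Prop where
  mem : ∀ k ∈ A, ((mon α k : MvPolynomial ι ℝ) : MvPowerSeries ι ℝ) ∈ formalInvariants Y
  linearIndependent : LinearIndependent ℝ (fun k : A => mon α (k : Fin p →₀ ℕ))
  spans : ∀ f ∈ formalInvariants Y, ∃ c : A → ℝ,
    IsFormalSum c (fun k : A => mon α (k : Fin p →₀ ℕ)) f

/-- An ideal of `ℝ[t₁, …, tₚ]` generated by monomials. -/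
def IsMonomialIdeal {p : ℕ} (I : Ideal (MvPolynomial (Fin p) ℝ)) : Prop :=
  ∃ S : Set (Fin p →₀ ℕ), I = Ideal.span ((fun k => MvPolynomial.monomial k (1 : ℝ)) '' S)

/-- `A` is the set of (exponents of) standard monomials of some monomial ideal. -/
def IsStandard {p : ℕ} (A : Set (Fin p →₀ ℕ)) : Prop :=
  ∃ I : Ideal (MvPolynomial (Fin p) ℝ), IsMonomialIdeal I ∧
    A = {k | MvPolynomial.monomial k (1 : ℝ) ∉ I}

/-- The data of one input (and of the output) of a box product: a triad, a Hilbert basis `α` for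
its invariants, and a standard preferred set `A` with respect to `α`. -/
structure IsBoxData {ι : Type*} [Fintype ι] (X Y Z : Matrix ι ι ℝ) {p : ℕ}
    (α : Fin p → MvPolynomial ι ℝ) (A : Set (Fin p →₀ ℕ)) : Prop where
  triad : IsTriad X Y Z
  hilbertBasis : IsHilbertBasis Y Z α
  preferred : IsPreferredSet Y α A
  standard : IsStandard A

/-- The coefficient `W^{sj}_{fg}` for weights `a` of `f` and `b` of `g`
(only used for `j ≤ s ≤ a`, `s ≤ b`, where no subtraction truncates). -/
def transvectantCoeff (a b s j : ℕ) : ℝ :=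
  (s.choose j : ℝ) * (((a - j)! : ℝ) / ((a - s)! : ℝ)) * (((b - s + j)! : ℝ) / ((b - s)! : ℝ))

/-- The external transvectant `(f, g)^{(s)} ∈ ℝ[x, y]` of `f ∈ ℝ[x]` and `g ∈ ℝ[y]`. Here
`X₁, Z₁` belong to the left triad and `X₂, Z₂` to the right one, and `𝒴 = 𝒟_X`. -/
def transvectant {ι κ : Type*} [Fintype ι] [Fintype κ] (X₁ Z₁ : Matrix ι ι ℝ)
    (X₂ Z₂ : Matrix κ κ ℝ) (f : MvPolynomial ι ℝ) (g : MvPolynomial κ ℝ) (s : ℕ) :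
    MvPolynomial (ι ⊕ κ) ℝ :=
  ∑ j ∈ Finset.range (s + 1),
    ((-1) ^ j * transvectantCoeff (weight Z₁ f) (weight Z₂ g) s j) •
      (MvPolynomial.rename Sum.inl ((polyD X₁)^[j] f) *
        MvPolynomial.rename Sum.inr ((polyD X₂)^[s - j] g))

/-- The integer vectors `(k; ℓ; s)`. -/
abbrev IntVec (p q : ℕ) : Type := (Fin p →₀ ℕ) × (Fin q →₀ ℕ) × ℕ

/-- The transvectant cone `𝒞`: the `(k; ℓ; s)` with `s ≤ ∑ aᵢ kᵢ` and `s ≤ ∑ bⱼ ℓⱼ`, where `a` and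
`b` are the row vectors of weights. -/
def cone {p q : ℕ} (a : Fin p → ℕ) (b : Fin q → ℕ) : Set (IntVec p q) :=
  {v | v.2.2 ≤ ∑ i, a i * v.1 i ∧ v.2.2 ≤ ∑ j, b j * v.2.1 j}

/-- `𝒞*`: the vectors of the cone whose transvectants are admissible for `A₁` and `A₂`. -/
def admissible {p q : ℕ} (a : Fin p → ℕ) (b : Fin q → ℕ)
    (A₁ : Set (Fin p →₀ ℕ)) (A₂ : Set (Fin q →₀ ℕ)) : Set (IntVec p q) :=
  {v | v ∈ cone a b ∧ v.1 ∈ A₁ ∧ v.2.1 ∈ A₂}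

/-- The primes `Π` of the cone: its nonzero elements that are not a sum of two nonzero elements
of the cone. -/
def primes {p q : ℕ} (a : Fin p → ℕ) (b : Fin q → ℕ) : Set (IntVec p q) :=
  {v | v ∈ cone a b ∧ v ≠ 0 ∧ ∀ u ∈ cone a b, ∀ w ∈ cone a b, v = u + w → u = 0 ∨ w = 0}

/-- The admissible primes `Π* = Π ∩ 𝒞*`. -/
def admissiblePrimes {p q : ℕ} (a : Fin p → ℕ) (b : Fin q → ℕ)
    (A₁ : Set (Fin p →₀ ℕ)) (A₂ : Set (Fin q →₀ ℕ)) : Set (IntVec p q) :=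
  primes a b ∩ admissible a b A₁ A₂

/-- The transvectant map `𝕋 (k; ℓ; s) = [k; ℓ; s] = (α ^ k, β ^ ℓ)^{(s)}`. -/
def transvectantMap {ι κ : Type*} [Fintype ι] [Fintype κ] (X₁ Z₁ : Matrix ι ι ℝ)
    (X₂ Z₂ : Matrix κ κ ℝ) {p q : ℕ} (α : Fin p → MvPolynomial ι ℝ)
    (β : Fin q → MvPolynomial κ ℝ) (v : IntVec p q) : MvPolynomial (ι ⊕ κ) ℝ :=
  transvectant X₁ Z₁ X₂ Z₂ (mon α v.1) (mon β v.2.1) v.2.2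

/-- `K` is the exponent vector obtained from `v ∈ 𝒞` by factoring out `π₁` as many times as
possible, then `π₂` as many times as possible from what remains, and so on, ending with a complete
factorization. A factor can be taken out when what remains is again in the cone, that is, is the
integer vector of a well-defined transvectant. -/
structure IsGreedy {p q t : ℕ} (a : Fin p → ℕ) (b : Fin q → ℕ) (π : Fin t → IntVec p q)
    (v : IntVec p q) (K : Fin t →₀ ℕ) : Prop where
  complete : v = ∑ i, K i • π i
  greatest : ∀ j, IsGreatest
    {c : ℕ | ∃ u ∈ cone a b, v = ∑ i ∈ Finset.Iio j, K i • π i + c • π j + u} (K j)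

section Product

variable {ι κ : Type*} [Fintype ι] [Fintype κ] (X₁ Z₁ : Matrix ι ι ℝ) (X₂ Z₂ : Matrix κ κ ℝ)
  {p q : ℕ} (α : Fin p → MvPolynomial ι ℝ) (β : Fin q → MvPolynomial κ ℝ)
  (A₁ : Set (Fin p →₀ ℕ)) (A₂ : Set (Fin q →₀ ℕ))

/-- The row vector of weights of `α`. -/
def weights (Z : Matrix ι ι ℝ) (α : Fin p → MvPolynomial ι ℝ) : Fin p → ℕ :=
  fun i => weight Z (α i)

/-- The pre-box product: the set of all admissible transvectants. -/
def preBoxProduct : Set (MvPolynomial (ι ⊕ κ) ℝ) :=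
  transvectantMap X₁ Z₁ X₂ Z₂ α β '' admissible (weights Z₁ α) (weights Z₂ β) A₁ A₂

/-- `ϑ ^ K` is a preferred factorization of the admissible transvectant `δ`, where `ϑ` is the tuple
of transvectants of the vectors `πᵢ`. -/
def IsPreferredFactorization {t : ℕ} (π : Fin t → IntVec p q) (δ : MvPolynomial (ι ⊕ κ) ℝ)
    (K : Fin t →₀ ℕ) : Prop :=
  ∃ v ∈ admissible (weights Z₁ α) (weights Z₂ β) A₁ A₂,
    transvectantMap X₁ Z₁ X₂ Z₂ α β v = δ ∧ IsGreedy (weights Z₁ α) (weights Z₂ β) π v K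

/-- The box product `A₁ ⊠_ϑ A₂` with factoring order `ϑᵢ = 𝕋 πᵢ`: the set of (exponents of) all
preferred factorizations of the transvectants in the pre-box product. -/
def boxProduct {t : ℕ} (π : Fin t → IntVec p q) : Set (Fin t →₀ ℕ) :=
  {K | ∃ δ ∈ preBoxProduct X₁ Z₁ X₂ Z₂ α β A₁ A₂,
    IsPreferredFactorization X₁ Z₁ X₂ Z₂ α β A₁ A₂ π δ K}

end Product

end BoxProduct

end

open BoxProduct

/-! Write `𝒳₁`, `𝒳₂` for `polyD` of `leftBlock Y₁`, `rightBlock Y₂`. They commute, their sum is `𝒳`,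
and so `𝒳₁ = -𝒳₂` on invariants. The proof rests on a leading term read off by powers of `𝒳₂`: for
`v = (k; ℓ; s)` in the cone, `𝒳₂ ^ s` sends the transvectant `[v]` to a positive multiple of `α ^ k
β ^ ℓ`, and higher powers kill it (`hasLeadingTerm_transvectantMap`). By the top term of Leibniz'
rule leading terms multiply and the vectors `v` add (`HasLeadingTerm.mul`). Hence `ϑ ^ K` has the
same leading term, up to a positive factor, as the transvectant of `∑ Kᵢ πᵢ`.

Any family of invariants that realizes every admissible leading term exactly once is a basis of the
polynomial invariants. Independence is triangularity in `s` (`linearIndependent_of_hasLeadingTerm`).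
For spanning (`mem_span_of_hasLeadingTerm`), let `𝒳₂ ^ (n + 1) h = 0` with `h` invariant. Then `𝒳₂ ^
n h` is killed by `𝒳₁` and `𝒳₂`, so it is a combination of products `α ^ k β ^ ℓ`. It also lies in
the images of `𝒳₁ ^ n` and `𝒳₂ ^ n`, which by `sl₂` theory forces both weights to be at least `n`,
so every `(k; ℓ; n)` that occurs is admissible. Subtracting elements with these leading terms lowers
`n`.

The rest is combinatorics of the cone. Its primes are finite in number by Dickson's lemma, and each
admissible vector has exactly one greedy factorization, so the exponents in the box product match
the admissible vectors one to one. A part of a greedy factorization is greedy, which gives closure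
under divisors. Formal series are treated degree by degree. -/

noncomputable section

namespace BoxProduct

open MvPolynomial

/-! ### Linear vector fields acting on polynomials. -/

section PolyD

variable {ι : Type*} [Fintype ι]

theorem polyD_apply (A : Matrix ι ι ℝ) (f : MvPolynomial ι ℝ) :
    polyD A f = ∑ i, (∑ j, A i j • (X j : MvPolynomial ι ℝ)) * pderiv i f := by
  have h : ∀ s : Finset ι, (∑ i ∈ s, (∑ j, A i j • (X j : MvPolynomial ι ℝ)) •
      (pderiv i : Derivation ℝ (MvPolynomial ι ℝ) (MvPolynomial ι ℝ))) f =
      ∑ i ∈ s, (∑ j, A i j • (X j : MvPolynomial ι ℝ)) * pderiv i f := by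
    classical
    intro s
    induction s using Finset.induction_on with
    | empty => simp
    | insert a s ha ih =>
      rw [Finset.sum_insert ha, Finset.sum_insert ha, Derivation.add_apply, ih]
      rfl
  exact h _

theorem polyD_X (A : Matrix ι ι ℝ) (i : ι) :
    polyD A (X i) = ∑ j, A i j • (X j : MvPolynomial ι ℝ) := by
  classical
  rw [polyD_apply, Finset.sum_eq_single i]
  · simp
  · intro b _ hb
    rw [pderiv_X_of_ne hb.symm, mul_zero]
  · simp

theorem polyD_add (A B : Matrix ι ι ℝ) (f : MvPolynomial ι ℝ) :
    polyD (A + B) f = polyD A f + polyD B f := by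
  have : polyD (A + B) = polyD A + polyD B := by
    apply derivation_ext
    intro i
    simp [polyD_X, add_smul, Finset.sum_add_distrib]
  rw [this, Derivation.add_apply]

theorem polyD_smul (c : ℝ) (A : Matrix ι ι ℝ) (f : MvPolynomial ι ℝ) :
    polyD (c • A) f = c • polyD A f := by
  have : polyD (c • A) = c • polyD A := by
    apply derivation_ext
    intro i
    simp [polyD_X, mul_smul, Finset.smul_sum]
  rw [this, Derivation.smul_apply]

theorem polyD_zero (f : MvPolynomial ι ℝ) : polyD (0 : Matrix ι ι ℝ) f = 0 := by
  simpa using polyD_smul 0 (0 : Matrix ι ι ℝ) f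

/-- Brackets are reversed in passing from matrices to vector fields. This is why `𝒟_Y` raises the
`𝒟_Z`-weight by 2 and `𝒟_X` lowers it, so that invariants are highest weight vectors. -/
theorem polyD_comm_sub (A B : Matrix ι ι ℝ) (f : MvPolynomial ι ℝ) :
    polyD A (polyD B f) - polyD B (polyD A f) = polyD (B * A - A * B) f := by
  have key : ∀ (A B : Matrix ι ι ℝ) (i : ι),
      polyD A (polyD B (X i)) = ∑ j, (B * A) i j • (X j : MvPolynomial ι ℝ) := by
    intro A B i
    rw [polyD_X, map_sum]
    simp only [Derivation.map_smul, polyD_X, Finset.smul_sum, Matrix.mul_apply, Finset.sum_smul,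
      smul_smul]
    exact Finset.sum_comm
  have : ⁅polyD A, polyD B⁆ = polyD (B * A - A * B) := by
    apply derivation_ext
    intro i
    rw [Derivation.commutator_apply, key, key, polyD_X, ← Finset.sum_sub_distrib]
    simp [sub_smul]
  rw [← this, Derivation.commutator_apply]

theorem isHomogeneous_polyD (A : Matrix ι ι ℝ) {f : MvPolynomial ι ℝ} {d : ℕ}
    (hf : f.IsHomogeneous d) : (polyD A f).IsHomogeneous d := by
  rw [polyD_apply]
  apply IsHomogeneous.sum
  intro i _
  have hl : (∑ j, A i j • (X j : MvPolynomial ι ℝ)).IsHomogeneous 1 := by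
    apply IsHomogeneous.sum
    intro j _
    rw [smul_eq_C_mul]
    exact isHomogeneous_C_mul_X _ _
  rcases Nat.eq_zero_or_pos d with rfl | hd
  · rw [← totalDegree_zero_iff_isHomogeneous, totalDegree_eq_zero_iff_eq_C] at hf
    rw [hf, pderiv_C, mul_zero]
    exact isHomogeneous_zero _ _ _
  · have := hl.mul (hf.pderiv (i := i))
    rwa [Nat.add_sub_cancel' hd] at this

theorem isHomogeneous_polyD_iterate (A : Matrix ι ι ℝ) {f : MvPolynomial ι ℝ} {d : ℕ}
    (hf : f.IsHomogeneous d) (n : ℕ) : ((polyD A)^[n] f).IsHomogeneous d := by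
  induction n with
  | zero => exact hf
  | succ n ih =>
    rw [Function.iterate_succ_apply']
    exact isHomogeneous_polyD A ih

end PolyD

/-! ### Iterates of derivations and the top term of Leibniz' rule. -/

section Iterates

variable {R : Type*} [CommRing R] [Algebra ℝ R] (D : Derivation ℝ R R)

theorem iterate_derivation_eq_pow (n : ℕ) (f : R) :
    D^[n] f = ((D : R →ₗ[ℝ] R) ^ n) f := by
  rw [Module.End.pow_apply]
  rfl

theorem iterate_derivation_zero (n : ℕ) : D^[n] 0 = 0 := by
  rw [iterate_derivation_eq_pow, map_zero]

theorem iterate_derivation_add (n : ℕ) (f g : R) : D^[n] (f + g) = D^[n] f + D^[n] g := by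
  simp only [iterate_derivation_eq_pow, map_add]

theorem iterate_derivation_sub (n : ℕ) (f g : R) : D^[n] (f - g) = D^[n] f - D^[n] g := by
  simp only [iterate_derivation_eq_pow, map_sub]

theorem iterate_derivation_smul (n : ℕ) (c : ℝ) (f : R) : D^[n] (c • f) = c • D^[n] f := by
  simp only [iterate_derivation_eq_pow, map_smul]

theorem iterate_derivation_sum {K : Type*} (n : ℕ) (s : Finset K) (f : K → R) :
    D^[n] (∑ k ∈ s, f k) = ∑ k ∈ s, D^[n] (f k) := by
  simp only [iterate_derivation_eq_pow, map_sum]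

theorem iterate_derivation_eq_zero_of_le {m n : ℕ} (h : m ≤ n) {f : R} (hf : D^[m] f = 0) :
    D^[n] f = 0 := by
  obtain ⟨k, rfl⟩ := Nat.exists_eq_add_of_le h
  rw [add_comm, Function.iterate_add_apply, hf, iterate_derivation_zero]

/-- The top term of Leibniz' rule for iterates. -/
theorem iterate_derivation_mul_top :
    ∀ (n a b : ℕ), a + b = n → ∀ f g : R, D^[a + 1] f = 0 → D^[b + 1] g = 0 →
      D^[n] (f * g) = (n.choose a : ℝ) • (D^[a] f * D^[b] g) := by
  intro n
  induction n with
  | zero =>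
    intro a b hab f g _ _
    obtain rfl : a = 0 := by omega
    obtain rfl : b = 0 := by omega
    simp
  | succ n ih =>
    intro a b hab f g hf hg
    rw [Function.iterate_succ_apply, Derivation.leibniz, iterate_derivation_add, smul_eq_mul,
      smul_eq_mul, mul_comm g]
    rcases Nat.eq_zero_or_pos a with rfl | ha
    · obtain rfl : b = n + 1 := by omega
      have hf' : D f = 0 := hf
      rw [hf', zero_mul, iterate_derivation_zero, ih 0 n (by omega) f (D g) hf hg]
      simp
    · obtain ⟨a, rfl⟩ := Nat.exists_eq_succ_of_ne_zero ha.ne'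
      rw [ih a b (by omega) (D f) g hf hg]
      rcases Nat.eq_zero_or_pos b with rfl | hb
      · obtain rfl : a = n := by omega
        have hg' : D g = 0 := hg
        rw [hg', mul_zero, iterate_derivation_zero]
        simp
      · obtain ⟨b, rfl⟩ := Nat.exists_eq_succ_of_ne_zero hb.ne'
        rw [ih (a + 1) b (by omega) f (D g) hf hg, Nat.succ_eq_add_one, Nat.succ_eq_add_one,
          Nat.choose_succ_succ', Function.iterate_succ_apply, Function.iterate_succ_apply]
        push_cast
        rw [add_smul, add_comm]

end Iterates

/-! ### Representation theory of `sl₂` on polynomials. -/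

section Sl2

variable {ι : Type*} [Fintype ι] {X₀ Y Z : Matrix ι ι ℝ}

theorem IsTriad.comm_Y_X (h : IsTriad X₀ Y Z) (f : MvPolynomial ι ℝ) :
    polyD Y (polyD X₀ f) = polyD X₀ (polyD Y f) + polyD Z f := by
  rw [← h.bracket_X_Y, ← polyD_comm_sub]
  abel

theorem IsTriad.comm_Z_Y (h : IsTriad X₀ Y Z) (f : MvPolynomial ι ℝ) :
    polyD Z (polyD Y f) = polyD Y (polyD Z f) + (2 : ℝ) • polyD Y f := by
  have h2 : Y * Z - Z * Y = (2 : ℝ) • Y := by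
    rw [← neg_sub, h.bracket_Z_Y, neg_smul, neg_neg]
  rw [← polyD_smul, ← h2, ← polyD_comm_sub]
  abel

theorem IsTriad.comm_Z_X (h : IsTriad X₀ Y Z) (f : MvPolynomial ι ℝ) :
    polyD Z (polyD X₀ f) = polyD X₀ (polyD Z f) - (2 : ℝ) • polyD X₀ f := by
  have h2 : X₀ * Z - Z * X₀ = (-2 : ℝ) • X₀ := by
    rw [← neg_sub, h.bracket_Z_X, neg_smul]
  rw [sub_eq_add_neg, ← neg_smul, ← polyD_smul, ← h2, ← polyD_comm_sub]
  abel

theorem IsTriad.Z_iterate_X (h : IsTriad X₀ Y Z) {f : MvPolynomial ι ℝ} {w : ℝ}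
    (hf : polyD Z f = w • f) (n : ℕ) :
    polyD Z ((polyD X₀)^[n] f) = (w - 2 * n) • (polyD X₀)^[n] f := by
  induction n with
  | zero => simpa using hf
  | succ n ih =>
    rw [Function.iterate_succ_apply', h.comm_Z_X, ih, Derivation.map_smul, ← sub_smul]
    congr 1
    push_cast
    ring

theorem IsTriad.Z_iterate_Y (h : IsTriad X₀ Y Z) (f : MvPolynomial ι ℝ) (n : ℕ) :
    polyD Z ((polyD Y)^[n] f) =
      (polyD Y)^[n] (polyD Z f) + (2 * n : ℝ) • (polyD Y)^[n] f := by
  induction n generalizing f with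
  | zero => simp
  | succ n ih =>
    rw [Function.iterate_succ_apply, ih, h.comm_Z_Y, iterate_derivation_add,
      iterate_derivation_smul, Function.iterate_succ_apply, add_assoc, ← add_smul]
    congr 2
    push_cast
    ring

theorem IsTriad.Y_iterate_X (h : IsTriad X₀ Y Z) {f : MvPolynomial ι ℝ} {w : ℝ}
    (hY : polyD Y f = 0) (hf : polyD Z f = w • f) (n : ℕ) :
    polyD Y ((polyD X₀)^[n + 1] f) = ((n + 1) * (w - n)) • (polyD X₀)^[n] f := by
  induction n with
  | zero => simp [h.comm_Y_X, hY, hf]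
  | succ n ih =>
    rw [Function.iterate_succ_apply', h.comm_Y_X, ih, Derivation.map_smul,
      h.Z_iterate_X hf, ← Function.iterate_succ_apply' (polyD X₀), ← add_smul]
    congr 1
    push_cast
    ring

/-- `𝒳 ^ s 𝒴 ^ s f` is a positive multiple of `f` if `s` is at most the weight of `f`. -/
theorem IsTriad.iterate_Y_iterate_X (h : IsTriad X₀ Y Z) {f : MvPolynomial ι ℝ} {w : ℕ}
    (hY : polyD Y f = 0) (hf : polyD Z f = (w : ℝ) • f) (s : ℕ) (hs : s ≤ w) :
    ∃ c : ℝ, 0 < c ∧ (polyD Y)^[s] ((polyD X₀)^[s] f) = c • f := by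
  induction s with
  | zero => exact ⟨1, one_pos, by simp⟩
  | succ s ih =>
    obtain ⟨c, hc, h'⟩ := ih (by omega)
    refine ⟨((s + 1) * ((w : ℝ) - s)) * c, ?_, ?_⟩
    · have : (s : ℝ) + 1 ≤ w := by exact_mod_cast hs
      have : 0 < (w : ℝ) - s := by linarith
      positivity
    · rw [Function.iterate_succ_apply, h.Y_iterate_X hY hf, iterate_derivation_smul, h', smul_smul]

/-- The identity `e ^ (s+1) f = f e ^ (s+1) + (s+1) (h - s) e ^ s` in the enveloping algebra, with
the first term killed by `hz`. It trades `z` for `𝒴 z` and raises the power of `𝒳` by one. -/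
theorem IsTriad.iterate_Y_X (h : IsTriad X₀ Y Z) (z : MvPolynomial ι ℝ) (s : ℕ)
    (hz : (polyD Y)^[s + 1] z = 0) :
    (polyD Y)^[s + 1] (polyD X₀ z) =
      ((s : ℝ) + 1) • (polyD Z ((polyD Y)^[s] z) - (s : ℝ) • (polyD Y)^[s] z) := by
  have key : ∀ (s : ℕ) (z : MvPolynomial ι ℝ), (polyD Y)^[s + 1] (polyD X₀ z) =
      polyD X₀ ((polyD Y)^[s + 1] z) +
      ((s : ℝ) + 1) • (polyD Z ((polyD Y)^[s] z) - (s : ℝ) • (polyD Y)^[s] z) := by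
    intro s
    induction s with
    | zero => intro z; simp [h.comm_Y_X]
    | succ s ih =>
      intro z
      have hZ : (polyD Y)^[s + 1] (polyD Z z) =
          polyD Z ((polyD Y)^[s + 1] z) - (2 * (s + 1 : ℕ) : ℝ) • (polyD Y)^[s + 1] z := by
        rw [h.Z_iterate_Y]
        abel
      rw [Function.iterate_succ_apply, h.comm_Y_X, iterate_derivation_add, ih, hZ,
        ← Function.iterate_succ_apply (polyD Y), ← Function.iterate_succ_apply (polyD Y)]
      push_cast
      module
  rw [key, hz, map_zero, zero_add]

/-- The commutator with `H` is a derivation, so every nonzero `E ^ n` is an eigenvector of it with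
eigenvalue `2n`. In finite dimension only finitely many eigenvalues occur. -/
theorem isNilpotent_of_commutator {A : Type*} [Ring A] [Algebra ℝ A] [Module.Finite ℝ A]
    {H E : A} (h : H * E - E * H = (2 : ℝ) • E) : IsNilpotent E := by
  by_contra hE
  have hE' : ∀ n, E ^ n ≠ 0 := fun n hn => hE ⟨n, hn⟩
  let φ : Module.End ℝ A := LinearMap.mulLeft ℝ H - LinearMap.mulRight ℝ H
  have hφ : ∀ n : ℕ, φ (E ^ n) = (2 * n : ℝ) • E ^ n := by
    intro n
    induction n with
    | zero => simp [φ]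
    | succ n ih =>
      simp only [φ, LinearMap.sub_apply, LinearMap.mulLeft_apply, LinearMap.mulRight_apply] at ih ⊢
      have : H * E ^ (n + 1) - E ^ (n + 1) * H =
          (H * E ^ n - E ^ n * H) * E + E ^ n * (H * E - E * H) := by
        rw [pow_succ]
        noncomm_ring
      rw [this, ih, h, smul_mul_assoc, mul_smul_comm, ← pow_succ, ← add_smul]
      congr 1
      push_cast
      ring
  have hev : ∀ n : ℕ, (2 * n : ℝ) ∈ {μ : ℝ | Module.End.HasEigenvalue φ μ} := fun n =>
    Module.End.hasEigenvalue_of_hasEigenvector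
      ⟨Module.End.mem_eigenspace_iff.mpr (hφ n), hE' n⟩
  refine Set.infinite_of_injective_forall_mem (f := fun n : ℕ => (2 * n : ℝ)) ?_ hev
    (Module.End.finite_hasEigenvalue φ)
  intro m n hmn
  have : (2 * m : ℝ) = 2 * n := hmn
  exact_mod_cast mul_left_cancel₀ two_ne_zero this

/-- `𝒳` is nilpotent on forms of a given degree. -/
theorem IsTriad.exists_iterate_Y_eq_zero (h : IsTriad X₀ Y Z) (d : ℕ) :
    ∃ N : ℕ, ∀ f : MvPolynomial ι ℝ, f.IsHomogeneous d → (polyD Y)^[N] f = 0 := by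
  let V := homogeneousSubmodule ι ℝ d
  have : Module.Finite ℝ V := Module.Finite.iff_fg.mpr (homogeneousSubmodule_fg _ _ d)
  have hst : ∀ A : Matrix ι ι ℝ, ∀ f ∈ V, (polyD A : MvPolynomial ι ℝ →ₗ[ℝ] _) f ∈ V :=
    fun A f hf => isHomogeneous_polyD A hf
  let E : Module.End ℝ V := (polyD Y : MvPolynomial ι ℝ →ₗ[ℝ] _).restrict (hst Y)
  let H : Module.End ℝ V := (polyD Z : MvPolynomial ι ℝ →ₗ[ℝ] _).restrict (hst Z)
  have hHE : H * E - E * H = (2 : ℝ) • E := by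
    ext1 f
    apply Subtype.ext
    have := h.comm_Z_Y (f : MvPolynomial ι ℝ)
    exact sub_eq_iff_eq_add'.mpr this
  obtain ⟨N, hN⟩ := isNilpotent_of_commutator (A := Module.End ℝ V) hHE
  refine ⟨N, fun f hf => ?_⟩
  have key : ∀ (n : ℕ) (g : V), ((E ^ n) g : MvPolynomial ι ℝ) = (polyD Y)^[n] g := by
    intro n
    induction n with
    | zero => intro g; rfl
    | succ n ih => intro g; rw [pow_succ, Module.End.mul_apply, ih]; rfl
  have := key N ⟨f, hf⟩
  rw [hN] at this
  exact this.symm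

theorem totalDegree_polyD_le (A : Matrix ι ι ℝ) {f : MvPolynomial ι ℝ} {d : ℕ}
    (hf : f.totalDegree ≤ d) : (polyD A f).totalDegree ≤ d := by
  rw [← sum_homogeneousComponent f, map_sum]
  refine totalDegree_finsetSum_le fun i hi => ?_
  have h := (isHomogeneous_polyD A (homogeneousComponent_isHomogeneous i f)).totalDegree_le
  have := Finset.mem_range.mp hi
  omega

/-- `𝒳` is nilpotent on polynomials of bounded degree. -/
theorem IsTriad.exists_iterate_Y_eq_zero_of_totalDegree_le (h : IsTriad X₀ Y Z) (d : ℕ) :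
    ∃ N : ℕ, ∀ f : MvPolynomial ι ℝ, f.totalDegree ≤ d → (polyD Y)^[N] f = 0 := by
  choose N hN using h.exists_iterate_Y_eq_zero
  refine ⟨(Finset.range (d + 1)).sup N, fun f hf => ?_⟩
  rw [← sum_homogeneousComponent f, iterate_derivation_sum]
  refine Finset.sum_eq_zero fun i hi => ?_
  have hi' : i ∈ Finset.range (d + 1) := by
    rw [Finset.mem_range] at hi ⊢
    omega
  exact iterate_derivation_eq_zero_of_le _ (Finset.le_sup hi')
    (hN i _ (homogeneousComponent_isHomogeneous i f))

/-- In the expansion of an invariant in the image of `𝒳 ^ s` with respect to weight vectors,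
only weights `s, s + 1, …` occur. -/
theorem IsTriad.weight_of_mem_image (h : IsTriad X₀ Y Z) {K : Type*} {e : K → MvPolynomial ι ℝ}
    (hli : LinearIndependent ℝ e) {w : K → ℝ} (he : ∀ k, polyD Z (e k) = w k • e k)
    {s : ℕ} {z : MvPolynomial ι ℝ} (hs : (polyD Y)^[s + 1] z = 0)
    (S : Finset K) (c : K → ℝ) (hzc : (polyD Y)^[s] z = ∑ k ∈ S, c k • e k)
    {k : K} (hk : k ∈ S) (hck : c k ≠ 0) : ∃ n : ℕ, w k = (s + n : ℕ) := by
  obtain ⟨N, hN⟩ := h.exists_iterate_Y_eq_zero_of_totalDegree_le z.totalDegree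
  -- Here `z'` is `𝒴 ^ n z`: each application of `𝒴` multiplies the coefficient of `e k` by
  -- `(s+n+1)(w k - (s+n))`. Degrees stay bounded, so for large `n` the left side vanishes by
  -- nilpotency. Independence then makes some factor zero wherever `c k ≠ 0`.
  have key : ∀ n : ℕ, ∃ z' : MvPolynomial ι ℝ, z'.totalDegree ≤ z.totalDegree ∧
      (polyD Y)^[s + n + 1] z' = 0 ∧ (polyD Y)^[s + n] z' =
        ∑ k ∈ S, (c k * ∏ i ∈ Finset.range n, ((i + s + 1 : ℕ) : ℝ) * (w k - (s + i : ℕ))) •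
          e k := by
    intro n
    induction n with
    | zero => exact ⟨z, le_rfl, hs, by simpa using hzc⟩
    | succ n ih =>
      obtain ⟨z', hz', h0, h1⟩ := ih
      have h2 := h.iterate_Y_X z' (s + n) h0
      refine ⟨polyD X₀ z', totalDegree_polyD_le _ hz', ?_, ?_⟩
      · have h3 : polyD Y ((polyD Y)^[s + n] z') = 0 := by
          rw [← Function.iterate_succ_apply' (polyD Y)]
          exact h0
        rw [Function.iterate_succ_apply', ← add_assoc, h2, Derivation.map_smul, map_sub,
          Derivation.map_smul, h3, smul_zero, sub_zero]
        have := h.comm_Z_Y ((polyD Y)^[s + n] z')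
        rw [h3, map_zero, smul_zero, add_zero] at this
        rw [← this, smul_zero]
      · rw [← add_assoc, h2, h1, map_sum, Finset.smul_sum, ← Finset.sum_sub_distrib,
          Finset.smul_sum]
        refine Finset.sum_congr rfl fun k _ => ?_
        rw [Derivation.map_smul, he, smul_smul, smul_smul, ← sub_smul, smul_smul,
          Finset.prod_range_succ]
        congr 1
        push_cast
        ring
  obtain ⟨z', hz', _, h1⟩ := key N
  rw [iterate_derivation_eq_zero_of_le _ (Nat.le_add_left N s) (hN z' hz')] at h1
  have h2 := linearIndependent_iff'.mp hli S _ h1.symm k hk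
  obtain ⟨i, _, hi⟩ := Finset.prod_eq_zero_iff.mp ((mul_eq_zero.mp h2).resolve_left hck)
  refine ⟨i, sub_eq_zero.mp ((mul_eq_zero.mp hi).resolve_left ?_)⟩
  exact Nat.cast_ne_zero.mpr (Nat.succ_ne_zero (i + s))

/-- The case `s = 0` of the preceding lemma, for the family consisting of `f` alone. -/
theorem IsTriad.exists_weight (h : IsTriad X₀ Y Z) {f : MvPolynomial ι ℝ}
    (hf : IsHomogeneousWeightInvariant Y Z f) : ∃ w : ℕ, polyD Z f = (w : ℝ) • f := by
  obtain ⟨hne, -, hinv, w, hw⟩ := hf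
  have hinv' : polyD Y f = 0 := hinv
  obtain ⟨n, hn⟩ := h.weight_of_mem_image (K := Unit) (e := fun _ => f)
    (linearIndependent_unique_iff.mpr hne) (w := fun _ => w) (fun _ => hw) (s := 0) (z := f) hinv'
    {()} 1 (by simp) (k := ()) (by simp) (by simp)
  refine ⟨0 + n, ?_⟩
  rw [hw, hn]

theorem weight_eq {f : MvPolynomial ι ℝ} (hne : f ≠ 0) {w : ℕ}
    (hw : polyD Z f = (w : ℝ) • f) : weight Z f = w := by
  have : {w : ℕ | polyD Z f = (w : ℝ) • f} = {w} := by
    ext v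
    constructor
    · intro hv
      have := smul_left_injective ℝ hne (hv.symm.trans hw)
      exact Nat.cast_injective this
    · rintro rfl
      exact hw
  rw [weight, this, csInf_singleton]

theorem IsTriad.polyD_Z_eq_weight (h : IsTriad X₀ Y Z) {f : MvPolynomial ι ℝ}
    (hf : IsHomogeneousWeightInvariant Y Z f) : polyD Z f = (weight Z f : ℝ) • f := by
  obtain ⟨w, hw⟩ := h.exists_weight hf
  rw [weight_eq hf.ne_zero hw, hw]

end Sl2

/-! ### Monomials in a Hilbert basis. -/

section Monomials

variable {ι : Type*} {p : ℕ} {α : Fin p → MvPolynomial ι ℝ}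

/-- Used with `w = 0` for invariance and with the weights for `𝒵`. -/
theorem polyD_finset_prod_pow (D : Derivation ℝ (MvPolynomial ι ℝ) (MvPolynomial ι ℝ))
    {w : Fin p → ℝ} (hD : ∀ i, D (α i) = w i • α i) (k : Fin p →₀ ℕ) :
    D (mon α k) = (∑ i, w i * k i) • mon α k := by
  classical
  have hpow : ∀ i (n : ℕ), D (α i ^ n) = (w i * n) • α i ^ n := by
    intro i n
    induction n with
    | zero => simp
    | succ n ih =>
      rw [pow_succ, Derivation.leibniz, ih, hD, smul_eq_mul, smul_eq_mul, mul_smul_comm,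
        mul_smul_comm, mul_comm (α i), ← add_smul]
      congr 1
      push_cast
      ring
  have hs : ∀ s : Finset (Fin p), D (∏ i ∈ s, α i ^ k i) =
      (∑ i ∈ s, w i * k i) • ∏ i ∈ s, α i ^ k i := by
    intro s
    induction s using Finset.induction_on with
    | empty => simp
    | insert a s ha ih =>
      rw [Finset.prod_insert ha, Finset.sum_insert ha, Derivation.leibniz, ih, hpow, smul_eq_mul,
        smul_eq_mul, mul_smul_comm, mul_smul_comm, mul_comm _ (α a ^ k a), ← add_smul, add_comm]
  exact hs _

theorem mon_ne_zero (hα : ∀ i, α i ≠ 0) (k : Fin p →₀ ℕ) : mon α k ≠ 0 :=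
  Finset.prod_ne_zero_iff.mpr fun i _ => pow_ne_zero _ (hα i)

theorem mon_isHomogeneous {d : Fin p → ℕ} (hα : ∀ i, (α i).IsHomogeneous (d i))
    (k : Fin p →₀ ℕ) : (mon α k).IsHomogeneous (∑ i, d i * k i) :=
  IsHomogeneous.prod _ _ _ fun i _ => (hα i).pow (k i)

variable [Fintype ι] {X₀ Y Z : Matrix ι ι ℝ}

theorem mon_mem_polyInvariants (hα : ∀ i, α i ∈ polyInvariants Y) (k : Fin p →₀ ℕ) :
    mon α k ∈ polyInvariants Y := by
  have := polyD_finset_prod_pow (polyD Y) (w := 0)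
    (fun i => by rw [(hα i : polyD Y (α i) = 0)]; simp) k
  change polyD Y (mon α k) = 0
  rw [this]
  simp

theorem IsTriad.polyD_Z_mon (h : IsTriad X₀ Y Z)
    (hα : ∀ i, IsHomogeneousWeightInvariant Y Z (α i)) (k : Fin p →₀ ℕ) :
    polyD Z (mon α k) = ((∑ i, weights Z α i * k i : ℕ) : ℝ) • mon α k := by
  rw [polyD_finset_prod_pow (polyD Z) (fun i => h.polyD_Z_eq_weight (hα i))]
  push_cast
  rfl

theorem mon_add {R : Type*} [CommMonoid R] (a : Fin p → R) (k l : Fin p →₀ ℕ) :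
    mon a (k + l) = mon a k * mon a l := by
  simp [mon, pow_add, Finset.prod_mul_distrib]

theorem mon_zero {R : Type*} [CommMonoid R] (a : Fin p → R) : mon a 0 = 1 := by
  simp [mon]

end Monomials

/-! ### Block-diagonal triads and the two commuting actions. -/

section Blocks

variable {ι κ : Type*}

/-- The matrix of `M`, acting on the left variables only. -/
abbrev leftBlock (M : Matrix ι ι ℝ) : Matrix (ι ⊕ κ) (ι ⊕ κ) ℝ := Matrix.fromBlocks M 0 0 0

/-- The matrix of `M`, acting on the right variables only. -/
abbrev rightBlock (M : Matrix κ κ ℝ) : Matrix (ι ⊕ κ) (ι ⊕ κ) ℝ := Matrix.fromBlocks 0 0 0 M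

variable [Fintype ι] [Fintype κ]

theorem polyD_fromBlocks (A : Matrix ι ι ℝ) (B : Matrix κ κ ℝ) (f : MvPolynomial (ι ⊕ κ) ℝ) :
    polyD (Matrix.fromBlocks A 0 0 B) f = polyD (leftBlock A) f + polyD (rightBlock B) f := by
  rw [← polyD_add, Matrix.fromBlocks_add]
  simp

theorem polyD_leftBlock_inl (A : Matrix ι ι ℝ) (f : MvPolynomial ι ℝ) :
    polyD (leftBlock A : Matrix (ι ⊕ κ) (ι ⊕ κ) ℝ) (rename Sum.inl f) =
      rename Sum.inl (polyD A f) := by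
  induction f using MvPolynomial.induction_on with
  | C a => simp [derivation_C]
  | add f g hf hg => simp only [map_add, hf, hg]
  | mul_X f i hf =>
    have hX : polyD (leftBlock A : Matrix (ι ⊕ κ) (ι ⊕ κ) ℝ) (X (Sum.inl i)) =
        rename Sum.inl (polyD A (X i)) := by
      simp [polyD_X, map_sum, Fintype.sum_sum_type]
    simp only [map_mul, Derivation.leibniz, hf, rename_X, hX, map_add, smul_eq_mul]

theorem polyD_rightBlock_inr (B : Matrix κ κ ℝ) (f : MvPolynomial κ ℝ) :
    polyD (rightBlock B : Matrix (ι ⊕ κ) (ι ⊕ κ) ℝ) (rename Sum.inr f) =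
      rename Sum.inr (polyD B f) := by
  induction f using MvPolynomial.induction_on with
  | C a => simp [derivation_C]
  | add f g hf hg => simp only [map_add, hf, hg]
  | mul_X f i hf =>
    have hX : polyD (rightBlock B : Matrix (ι ⊕ κ) (ι ⊕ κ) ℝ) (X (Sum.inr i)) =
        rename Sum.inr (polyD B (X i)) := by
      simp [polyD_X, map_sum, Fintype.sum_sum_type]
    simp only [map_mul, Derivation.leibniz, hf, rename_X, hX, map_add, smul_eq_mul]

theorem polyD_leftBlock_inr (A : Matrix ι ι ℝ) (f : MvPolynomial κ ℝ) :
    polyD (leftBlock A : Matrix (ι ⊕ κ) (ι ⊕ κ) ℝ) (rename Sum.inr f) = 0 := by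
  induction f using MvPolynomial.induction_on with
  | C a => simp [derivation_C]
  | add f g hf hg => simp only [map_add, hf, hg, add_zero]
  | mul_X f i hf => simp [Derivation.leibniz, hf, polyD_X]

theorem polyD_rightBlock_inl (B : Matrix κ κ ℝ) (f : MvPolynomial ι ℝ) :
    polyD (rightBlock B : Matrix (ι ⊕ κ) (ι ⊕ κ) ℝ) (rename Sum.inl f) = 0 := by
  induction f using MvPolynomial.induction_on with
  | C a => simp [derivation_C]
  | add f g hf hg => simp only [map_add, hf, hg, add_zero]
  | mul_X f i hf => simp [Derivation.leibniz, hf, polyD_X]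

theorem polyD_leftBlock_mul (A : Matrix ι ι ℝ) (f : MvPolynomial ι ℝ) (g : MvPolynomial κ ℝ) :
    polyD (leftBlock A : Matrix (ι ⊕ κ) (ι ⊕ κ) ℝ) (rename Sum.inl f * rename Sum.inr g) =
      rename Sum.inl (polyD A f) * rename Sum.inr g := by
  rw [Derivation.leibniz, polyD_leftBlock_inl, polyD_leftBlock_inr, smul_zero, zero_add,
    smul_eq_mul, mul_comm]

theorem polyD_rightBlock_mul (B : Matrix κ κ ℝ) (f : MvPolynomial ι ℝ) (g : MvPolynomial κ ℝ) :
    polyD (rightBlock B : Matrix (ι ⊕ κ) (ι ⊕ κ) ℝ) (rename Sum.inl f * rename Sum.inr g) =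
      rename Sum.inl f * rename Sum.inr (polyD B g) := by
  rw [Derivation.leibniz, polyD_rightBlock_inl, polyD_rightBlock_inr, smul_zero, add_zero,
    smul_eq_mul]

theorem iterate_polyD_rightBlock_mul (B : Matrix κ κ ℝ) (f : MvPolynomial ι ℝ)
    (g : MvPolynomial κ ℝ) (n : ℕ) :
    (polyD (rightBlock B : Matrix (ι ⊕ κ) (ι ⊕ κ) ℝ))^[n] (rename Sum.inl f * rename Sum.inr g) =
      rename Sum.inl f * rename Sum.inr ((polyD B)^[n] g) := by
  induction n with
  | zero => rfl
  | succ n ih => rw [Function.iterate_succ_apply', ih, polyD_rightBlock_mul,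
      Function.iterate_succ_apply']

theorem polyD_leftBlock_rightBlock_comm (A : Matrix ι ι ℝ) (B : Matrix κ κ ℝ)
    (f : MvPolynomial (ι ⊕ κ) ℝ) :
    polyD (leftBlock A) (polyD (rightBlock B) f) =
      polyD (rightBlock B) (polyD (leftBlock A) f) := by
  rw [← sub_eq_zero, polyD_comm_sub, Matrix.fromBlocks_multiply, Matrix.fromBlocks_multiply]
  simp [polyD_zero]

theorem IsTriad.fromBlocks {X₁ Y₁ Z₁ : Matrix ι ι ℝ} {X₂ Y₂ Z₂ : Matrix κ κ ℝ}
    (h₁ : IsTriad X₁ Y₁ Z₁) (h₂ : IsTriad X₂ Y₂ Z₂) :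
    IsTriad (Matrix.fromBlocks X₁ 0 0 X₂) (Matrix.fromBlocks Y₁ 0 0 Y₂)
      (Matrix.fromBlocks Z₁ 0 0 Z₂) := by
  have hsub : ∀ (A A' : Matrix ι ι ℝ) (B B' : Matrix κ κ ℝ),
      Matrix.fromBlocks A 0 0 B - Matrix.fromBlocks A' 0 0 B' =
        Matrix.fromBlocks (A - A') 0 0 (B - B') := by
    intro A A' B B'
    simp [sub_eq_add_neg, Matrix.fromBlocks_neg, Matrix.fromBlocks_add]
  constructor <;>
    simp only [Matrix.fromBlocks_multiply, Matrix.fromBlocks_smul, Matrix.mul_zero,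
      Matrix.zero_mul, add_zero, zero_add, smul_zero, hsub, h₁.bracket_X_Y, h₂.bracket_X_Y,
      h₁.bracket_Z_X, h₂.bracket_Z_X, h₁.bracket_Z_Y, h₂.bracket_Z_Y]

theorem isTriad_zero : IsTriad (0 : Matrix ι ι ℝ) 0 0 := by constructor <;> simp

/-- Padding with the zero triad makes the `sl₂` lemmas available in the product ring for each factor
separately. -/
theorem IsTriad.leftBlock {X₁ Y₁ Z₁ : Matrix ι ι ℝ} (h₁ : IsTriad X₁ Y₁ Z₁) :
    IsTriad (leftBlock X₁ : Matrix (ι ⊕ κ) (ι ⊕ κ) ℝ) (BoxProduct.leftBlock Y₁)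
      (BoxProduct.leftBlock Z₁) :=
  h₁.fromBlocks isTriad_zero

theorem IsTriad.rightBlock {X₂ Y₂ Z₂ : Matrix κ κ ℝ} (h₂ : IsTriad X₂ Y₂ Z₂) :
    IsTriad (rightBlock X₂ : Matrix (ι ⊕ κ) (ι ⊕ κ) ℝ) (BoxProduct.rightBlock Y₂)
      (BoxProduct.rightBlock Z₂) :=
  isTriad_zero.fromBlocks h₂

end Blocks

/-! ### `ℝ[x, y]` as a tensor product. -/

section Tensor

open TensorProduct

variable {ι κ : Type*}

theorem tensorEquivSum_tmul (f : MvPolynomial ι ℝ) (g : MvPolynomial κ ℝ) :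
    tensorEquivSum ℝ ι κ ℝ (f ⊗ₜ g) = rename Sum.inl f * rename Sum.inr g := by
  have h1 : ∀ f : MvPolynomial ι ℝ, tensorEquivSum ℝ ι κ ℝ (f ⊗ₜ 1) = rename Sum.inl f := by
    have : (tensorEquivSum ℝ ι κ ℝ).toAlgHom.comp Algebra.TensorProduct.includeLeft =
        rename Sum.inl := by
      apply algHom_ext
      intro i
      simp
    exact fun f => DFunLike.congr_fun this f
  have h2 : ∀ g : MvPolynomial κ ℝ, tensorEquivSum ℝ ι κ ℝ (1 ⊗ₜ g) = rename Sum.inr g := by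
    have : (tensorEquivSum ℝ ι κ ℝ).toAlgHom.comp Algebra.TensorProduct.includeRight =
        rename Sum.inr := by
      apply algHom_ext
      intro i
      simp
    exact fun f => DFunLike.congr_fun this f
  rw [← h1, ← h2, ← map_mul, Algebra.TensorProduct.tmul_mul_tmul, mul_one, one_mul]

theorem linearIndependent_inl_mul_inr {K L : Type*} {e : K → MvPolynomial ι ℝ}
    {e' : L → MvPolynomial κ ℝ} (he : LinearIndependent ℝ e) (he' : LinearIndependent ℝ e') :
    LinearIndependent ℝ (fun kl : K × L => rename Sum.inl (e kl.1) * rename Sum.inr (e' kl.2)) := by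
  have h := (he.tmul_of_flat_left he').map' (tensorEquivSum ℝ ι κ ℝ).toLinearMap
    (LinearMap.ker_eq_bot.mpr (tensorEquivSum ℝ ι κ ℝ).injective)
  have heq : (fun kl : K × L => rename Sum.inl (e kl.1) * rename Sum.inr (e' kl.2)) =
      (tensorEquivSum ℝ ι κ ℝ).toLinearMap ∘ fun kl => e kl.1 ⊗ₜ e' kl.2 :=
    funext fun kl => (tensorEquivSum_tmul _ _).symm
  rw [heq]
  exact h

theorem inl_mul_inr_mem_span {K L : Type*} {e : K → MvPolynomial ι ℝ}
    {e' : L → MvPolynomial κ ℝ} {f : MvPolynomial ι ℝ} {g : MvPolynomial κ ℝ}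
    (hf : f ∈ Submodule.span ℝ (Set.range e)) (hg : g ∈ Submodule.span ℝ (Set.range e')) :
    rename Sum.inl f * rename Sum.inr g ∈ Submodule.span ℝ
      (Set.range fun kl : K × L => rename Sum.inl (e kl.1) * rename Sum.inr (e' kl.2)) := by
  induction hf using Submodule.span_induction with
  | mem f hf =>
    obtain ⟨k, rfl⟩ := hf
    induction hg using Submodule.span_induction with
    | mem g hg =>
      obtain ⟨l, rfl⟩ := hg
      exact Submodule.subset_span ⟨(k, l), rfl⟩
    | zero => simp
    | add g g' _ _ h h' =>
      rw [map_add, mul_add]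
      exact Submodule.add_mem _ h h'
    | smul a g _ h =>
      rw [map_smul, mul_smul_comm]
      exact Submodule.smul_mem _ _ h
  | zero => simp
  | add f f' _ _ h h' =>
    rw [map_add, add_mul]
    exact Submodule.add_mem _ h h'
  | smul a f _ h =>
    rw [map_smul, smul_mul_assoc]
    exact Submodule.smul_mem _ _ h

variable [Fintype ι] [Fintype κ]

/-- The polynomials that are invariant in the left and in the right variables are spanned by the
products of invariants. -/
theorem mem_span_of_left_right_invariant {K L : Type*} {e : K → MvPolynomial ι ℝ}
    {e' : L → MvPolynomial κ ℝ} {Y₁ : Matrix ι ι ℝ} {Y₂ : Matrix κ κ ℝ}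
    (he : ∀ f ∈ polyInvariants Y₁, f ∈ Submodule.span ℝ (Set.range e))
    (he' : ∀ f ∈ polyInvariants Y₂, f ∈ Submodule.span ℝ (Set.range e'))
    {f : MvPolynomial (ι ⊕ κ) ℝ} (h₁ : polyD (leftBlock Y₁) f = 0)
    (h₂ : polyD (rightBlock Y₂) f = 0) :
    f ∈ Submodule.span ℝ
      (Set.range fun kl : K × L => rename Sum.inl (e kl.1) * rename Sum.inr (e' kl.2)) := by
  let φ := (tensorEquivSum ℝ ι κ ℝ).toLinearEquiv
  let D₁ : Module.End ℝ (MvPolynomial ι ℝ) := polyD Y₁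
  let D₂ : Module.End ℝ (MvPolynomial κ ℝ) := polyD Y₂
  have hφ₁ : ∀ t, φ (D₁.rTensor (MvPolynomial κ ℝ) t) = polyD (leftBlock Y₁) (φ t) := by
    intro t
    induction t using TensorProduct.induction_on with
    | zero => simp
    | tmul f g =>
      rw [LinearMap.rTensor_tmul]
      refine (tensorEquivSum_tmul _ _).trans ((polyD_leftBlock_mul _ _ _).symm.trans ?_)
      rw [← tensorEquivSum_tmul]
      rfl
    | add x y hx hy => simp only [map_add, hx, hy]
  have hφ₂ : ∀ t, φ (D₂.lTensor (MvPolynomial ι ℝ) t) = polyD (rightBlock Y₂) (φ t) := by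
    intro t
    induction t using TensorProduct.induction_on with
    | zero => simp
    | tmul f g =>
      rw [LinearMap.lTensor_tmul]
      refine (tensorEquivSum_tmul _ _).trans ((polyD_rightBlock_mul _ _ _).symm.trans ?_)
      rw [← tensorEquivSum_tmul]
      rfl
    | add x y hx hy => simp only [map_add, hx, hy]
  obtain ⟨t, rfl⟩ := φ.surjective f
  rw [← hφ₁, LinearEquiv.map_eq_zero_iff] at h₁
  rw [← hφ₂, LinearEquiv.map_eq_zero_iff] at h₂
  -- By flatness the kernel of `D₁ ⊗ 1` is `ker D₁ ⊗ ℝ[y]`. This embeds in `ℝ[x] ⊗ ℝ[y]`, so `1 ⊗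
  -- D₂` already kills `t` there, and flatness once more puts `t` in `ker D₁ ⊗ ker D₂`.
  obtain ⟨t, rfl⟩ :=
    (Module.Flat.rTensor_exact (MvPolynomial κ ℝ) D₁.exact_subtype_ker_map t).mp h₁
  have h₃ : D₂.lTensor (LinearMap.ker D₁) t = 0 := by
    apply Module.Flat.rTensor_preserves_injective_linearMap (M := MvPolynomial κ ℝ)
      (LinearMap.ker D₁).subtype Subtype.val_injective
    rw [map_zero, ← h₂]
    simp only [← LinearMap.comp_apply, LinearMap.rTensor_comp_lTensor,
      LinearMap.lTensor_comp_rTensor]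
  obtain ⟨t, rfl⟩ :=
    (Module.Flat.lTensor_exact (LinearMap.ker D₁) D₂.exact_subtype_ker_map t).mp h₃
  clear h₁ h₂ h₃
  induction t using TensorProduct.induction_on with
  | zero => simp
  | tmul f g =>
    have := inl_mul_inr_mem_span (he f f.2) (he' g g.2)
    rwa [← tensorEquivSum_tmul] at this
  | add x y hx hy =>
    rw [map_add, map_add, map_add]
    exact Submodule.add_mem _ hx hy

end Tensor

/-! ### From polynomials to formal power series and back. -/

section Formal

variable {ι : Type*} [Fintype ι]

theorem formalD_apply (A : Matrix ι ι ℝ) (f : MvPowerSeries ι ℝ) :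
    formalD A f =
      ∑ i, (∑ j, A i j • (MvPowerSeries.X j : MvPowerSeries ι ℝ)) * MvPowerSeries.pderiv ℝ i f := by
  have h : ∀ s : Finset ι, (∑ i ∈ s, (∑ j, A i j • (MvPowerSeries.X j : MvPowerSeries ι ℝ)) •
      (MvPowerSeries.pderiv ℝ i : Derivation ℝ (MvPowerSeries ι ℝ) (MvPowerSeries ι ℝ))) f =
      ∑ i ∈ s, (∑ j, A i j • (MvPowerSeries.X j : MvPowerSeries ι ℝ)) *
        MvPowerSeries.pderiv ℝ i f := by
    classical
    intro s
    induction s using Finset.induction_on with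
    | empty => simp
    | insert a s ha ih =>
      rw [Finset.sum_insert ha, Finset.sum_insert ha, Derivation.add_apply, ih]
      rfl
  exact h _

theorem formalD_coe (A : Matrix ι ι ℝ) (f : MvPolynomial ι ℝ) :
    formalD A (f : MvPowerSeries ι ℝ) = (polyD A f : MvPolynomial ι ℝ) := by
  rw [formalD_apply, polyD_apply]
  simp only [← coeToMvPowerSeries.ringHom_apply, map_sum, map_mul, MvPolynomial.smul_eq_C_mul]
  simp [MvPowerSeries.pderiv_coe, MvPowerSeries.smul_eq_C_mul]

theorem coe_mem_formalInvariants {Y : Matrix ι ι ℝ} {f : MvPolynomial ι ℝ} :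
    (f : MvPowerSeries ι ℝ) ∈ formalInvariants Y ↔ f ∈ polyInvariants Y := by
  change formalD Y f = 0 ↔ polyD Y f = 0
  rw [formalD_coe, coe_eq_zero_iff]

/-- The coefficients of `formalD A f` in degree `d` depend only on those of `f` in degree `d`. -/
theorem coeff_formalD_congr (A : Matrix ι ι ℝ) {f g : MvPowerSeries ι ℝ} {n : ι →₀ ℕ}
    (h : ∀ m : ι →₀ ℕ, m.degree = n.degree → MvPowerSeries.coeff m f = MvPowerSeries.coeff m g) :
    MvPowerSeries.coeff n (formalD A f) = MvPowerSeries.coeff n (formalD A g) := by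
  rw [formalD_apply, formalD_apply, map_sum, map_sum]
  refine Finset.sum_congr rfl fun i _ => ?_
  rw [Finset.sum_mul, Finset.sum_mul, map_sum, map_sum]
  refine Finset.sum_congr rfl fun j _ => ?_
  rw [smul_mul_assoc, smul_mul_assoc, map_smul, map_smul]
  congr 1
  rw [MvPowerSeries.X, MvPowerSeries.coeff_monomial_mul, MvPowerSeries.coeff_monomial_mul]
  split_ifs with hj
  · rw [MvPowerSeries.coeff_pderiv, MvPowerSeries.coeff_pderiv, h]
    obtain ⟨k, rfl⟩ := exists_add_of_le hj
    simp [add_comm]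
  · rfl

/-- Linear vector fields preserve degree, so each homogeneous part of an invariant series is
invariant. -/
theorem exists_homogeneous_part {Y : Matrix ι ι ℝ} {f : MvPowerSeries ι ℝ}
    (hf : f ∈ formalInvariants Y) (d : ℕ) :
    ∃ g ∈ polyInvariants Y, ∀ m : ι →₀ ℕ, m.degree = d → g.coeff m = MvPowerSeries.coeff m f := by
  have hg : (homogeneousComponent d (f.truncTotal (d + 1))).IsHomogeneous d :=
    homogeneousComponent_isHomogeneous _ _
  have hc : ∀ m : ι →₀ ℕ, m.degree = d →
      (homogeneousComponent d (f.truncTotal (d + 1))).coeff m = MvPowerSeries.coeff m f := by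
    intro m hm
    rw [coeff_homogeneousComponent, if_pos hm, MvPowerSeries.coeff_truncTotal _ (by omega)]
  refine ⟨_, ?_, hc⟩
  change polyD Y _ = 0
  ext m
  by_cases hm : m.degree = d
  · rw [← coeff_coe, ← formalD_coe, coeff_formalD_congr Y (g := f), (hf : formalD Y f = 0)]
    · simp
    · intro m' hm'
      rw [coeff_coe]
      exact hc _ (hm'.trans hm)
  · rw [(isHomogeneous_polyD Y hg).coeff_eq_zero hm, coeff_zero]

/-- A family of forms spanning the polynomial invariants spans the formal invariants formally. -/
theorem exists_isFormalSum {K : Type*} {e : K → MvPolynomial ι ℝ} {Y : Matrix ι ι ℝ} {δ : K → ℕ}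
    (hδ : ∀ k, (e k).IsHomogeneous (δ k))
    (he : ∀ f ∈ polyInvariants Y, f ∈ Submodule.span ℝ (Set.range e))
    {f : MvPowerSeries ι ℝ} (hf : f ∈ formalInvariants Y) :
    ∃ c : K → ℝ, IsFormalSum c e f := by
  choose g hgY hgc using exists_homogeneous_part hf
  have h := fun d => Finsupp.mem_span_range_iff_exists_finsupp.mp (he _ (hgY d))
  choose c hc using h
  -- The coefficient of `e k` comes from the expansion of the part of `f` in the degree of `e k`. At
  -- a given `m` it may be replaced by the one from degree `m.degree`, since otherwise `e k` has no
  -- coefficient at `m`.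
  refine ⟨fun k => c (δ k) k, fun m => ?_⟩
  have hcm : ∀ k, c (δ k) k * (e k).coeff m = c m.degree k * (e k).coeff m := by
    intro k
    by_cases hk : m.degree = δ k
    · rw [hk]
    · rw [(hδ k).coeff_eq_zero hk, mul_zero, mul_zero]
  have hsub : (Function.support fun k => c m.degree k * (e k).coeff m) ⊆ (c m.degree).support := by
    intro k hk
    exact Finsupp.mem_support_iff.mpr (left_ne_zero_of_mul hk)
  simp only [hcm]
  refine ⟨(Finset.finite_toSet _).subset hsub, ?_⟩
  rw [finsum_eq_sum_of_support_subset _ hsub, ← hgc _ m rfl, ← hc, Finsupp.sum, coeff_sum]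
  simp

/-- A formal expansion of a polynomial `f` may be cut off above the degree of `f`, since the basis
elements are homogeneous. What remains is finite: each remaining term has a monomial of bounded
degree, and each of these finitely many monomials meets finitely many terms. -/
theorem IsPreferredSet.mem_span {Y : Matrix ι ι ℝ} {p : ℕ} {α : Fin p → MvPolynomial ι ℝ}
    {A : Set (Fin p →₀ ℕ)} (hA : IsPreferredSet Y α A) (hα : ∀ i, ∃ d, (α i).IsHomogeneous d)
    (hne : ∀ i, α i ≠ 0) {f : MvPolynomial ι ℝ} (hf : f ∈ polyInvariants Y) :
    f ∈ Submodule.span ℝ (Set.range fun k : A => mon α k) := by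
  choose δ hδ using hα
  let deg : A → ℕ := fun k => ∑ i, δ i * (k : Fin p →₀ ℕ) i
  have hdeg : ∀ k : A, (mon α k).IsHomogeneous (deg k) := fun k => mon_isHomogeneous hδ k
  obtain ⟨c, hc⟩ := hA.spans f (coe_mem_formalInvariants.mpr hf)
  have hfin : {k : A | c k ≠ 0 ∧ deg k ≤ f.totalDegree}.Finite := by
    refine ((Finsupp.finite_of_degree_le (σ := ι) f.totalDegree).biUnion
      fun m _ => (hc m).1).subset ?_
    rintro k ⟨hk, hkd⟩
    obtain ⟨m, hm⟩ := ne_zero_iff.mp (mon_ne_zero hne (k : Fin p →₀ ℕ))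
    refine Set.mem_biUnion (x := m) ?_ (mul_ne_zero hk hm)
    change m.degree ≤ _
    rwa [not_imp_comm.mp (hdeg k).coeff_eq_zero hm]
  have hsum : f = ∑ k ∈ hfin.toFinset, c k • mon α (k : Fin p →₀ ℕ) := by
    ext m
    rw [coeff_sum]
    simp only [coeff_smul, smul_eq_mul]
    by_cases hm : m.degree ≤ f.totalDegree
    · rw [← coeff_coe, (hc m).2]
      refine finsum_eq_sum_of_support_subset _ fun k hk => ?_
      have hk' := mul_ne_zero_iff.mp hk
      rw [Finset.mem_coe, Set.Finite.mem_toFinset]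
      refine ⟨hk'.1, ?_⟩
      rwa [← not_imp_comm.mp (hdeg k).coeff_eq_zero hk'.2]
    · rw [coeff_eq_zero_of_totalDegree_lt (not_le.mp hm), Finset.sum_eq_zero]
      intro k hk
      rw [Set.Finite.mem_toFinset] at hk
      rw [(hdeg k).coeff_eq_zero (fun h => hm (h ▸ hk.2)), mul_zero]
  rw [hsum]
  exact Submodule.sum_mem _ fun k _ => Submodule.smul_mem _ _ (Submodule.subset_span ⟨k, rfl⟩)

end Formal

/-- A monomial lies in a monomial ideal iff a generator divides it. Conversely, a set closed under
divisors comes from the ideal generated by the monomials outside it. -/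
theorem isStandard_iff {p : ℕ} {A : Set (Fin p →₀ ℕ)} :
    IsStandard A ↔ ∀ k ∈ A, ∀ l ≤ k, l ∈ A := by
  have hmem : ∀ (S : Set (Fin p →₀ ℕ)) (k : Fin p →₀ ℕ), monomial k (1 : ℝ) ∈
      Ideal.span ((fun k => monomial k (1 : ℝ)) '' S) ↔ ∃ l ∈ S, l ≤ k := by
    intro S k
    rw [mem_ideal_span_monomial_image, support_monomial, if_neg one_ne_zero]
    simp
  constructor
  · rintro ⟨_, ⟨S, rfl⟩, rfl⟩ k hk l hl hl'
    obtain ⟨m, hm, hml⟩ := (hmem S l).mp hl'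
    exact hk ((hmem S k).mpr ⟨m, hm, hml.trans hl⟩)
  · intro h
    refine ⟨_, ⟨Aᶜ, rfl⟩, ?_⟩
    ext k
    change k ∈ A ↔ ¬ _
    rw [hmem]
    constructor
    · rintro hk ⟨l, hl, hlk⟩
      exact hl (h k hk l hlk)
    · intro hk
      by_contra hkA
      exact hk ⟨k, hkA, le_rfl⟩

/-! ### Transvectants: invariance and leading term. -/

theorem transvectantCoeff_zero_pos (a b s : ℕ) : 0 < transvectantCoeff a b s 0 := by
  unfold transvectantCoeff
  rw [Nat.choose_zero_right]
  positivity

open scoped Nat in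
-- The ratio of consecutive coefficients that makes `𝒳` annihilate the transvectant.
theorem transvectantCoeff_succ {a b s j : ℕ} (hj : j < s) (ha : s ≤ a) (hb : s ≤ b) :
    transvectantCoeff a b s (j + 1) * ((j + 1 : ℝ) * (a - j)) =
      transvectantCoeff a b s j * ((s - j : ℝ) * (b - s + j + 1)) := by
  unfold transvectantCoeff
  have h1 : (s.choose (j + 1) : ℝ) * (j + 1) = s.choose j * (s - j) := by
    have := Nat.choose_succ_right_eq s j
    rw [← Nat.cast_sub hj.le]
    exact_mod_cast this
  have h2 : ((a - j)! : ℝ) = (a - j) * (a - (j + 1))! := by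
    obtain ⟨m, rfl⟩ : ∃ m, a = m + j + 1 := ⟨a - j - 1, by omega⟩
    rw [show m + j + 1 - j = m + 1 by omega, show m + j + 1 - (j + 1) = m by omega,
      Nat.factorial_succ]
    push_cast
    ring
  have h3 : ((b - s + (j + 1))! : ℝ) = (b - s + j + 1) * (b - s + j)! := by
    rw [← add_assoc, Nat.factorial_succ, ← Nat.cast_sub hb]
    push_cast
    ring
  rw [h2, h3]
  linear_combination ((a - (j + 1))! : ℝ) / ((a - s)! : ℝ) *
    ((b - s + j + 1) * (b - s + j)! / ((b - s)! : ℝ)) * (a - j) * h1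

section Transvectant

variable {ι κ : Type*} [Fintype ι] [Fintype κ] {X₁ Y₁ Z₁ : Matrix ι ι ℝ} {X₂ Y₂ Z₂ : Matrix κ κ ℝ}
  {f : MvPolynomial ι ℝ} {g : MvPolynomial κ ℝ} {s : ℕ}

theorem isHomogeneous_transvectant {d e : ℕ} (hf : f.IsHomogeneous d) (hg : g.IsHomogeneous e) :
    (transvectant X₁ Z₁ X₂ Z₂ f g s).IsHomogeneous (d + e) := by
  refine IsHomogeneous.sum _ _ _ fun j _ => ?_
  rw [smul_eq_C_mul]
  exact ((isHomogeneous_polyD_iterate X₁ hf j).rename_isHomogeneous.mul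
    (isHomogeneous_polyD_iterate X₂ hg (s - j)).rename_isHomogeneous).C_mul _

theorem polyD_Z_transvectant (h₁ : IsTriad X₁ Y₁ Z₁) (h₂ : IsTriad X₂ Y₂ Z₂) {a b : ℝ}
    (hfZ : polyD Z₁ f = a • f) (hgZ : polyD Z₂ g = b • g) :
    polyD (Matrix.fromBlocks Z₁ 0 0 Z₂) (transvectant X₁ Z₁ X₂ Z₂ f g s) =
      (a + b - 2 * s) • transvectant X₁ Z₁ X₂ Z₂ f g s := by
  unfold transvectant
  rw [map_sum, Finset.smul_sum]
  refine Finset.sum_congr rfl fun j hj => ?_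
  have hj : j ≤ s := Nat.lt_succ_iff.mp (Finset.mem_range.mp hj)
  rw [Derivation.map_smul, polyD_fromBlocks, polyD_leftBlock_mul, polyD_rightBlock_mul,
    h₁.Z_iterate_X hfZ, h₂.Z_iterate_X hgZ, map_smul, map_smul, smul_mul_assoc, mul_smul_comm,
    ← add_smul, smul_comm]
  congr 1
  rw [Nat.cast_sub hj]
  ring

theorem polyD_Y_transvectant (h₁ : IsTriad X₁ Y₁ Z₁) (h₂ : IsTriad X₂ Y₂ Z₂)
    (hf₀ : f ≠ 0) (hfY : polyD Y₁ f = 0) {a : ℕ} (hfZ : polyD Z₁ f = (a : ℝ) • f)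
    (hg₀ : g ≠ 0) (hgY : polyD Y₂ g = 0) {b : ℕ} (hgZ : polyD Z₂ g = (b : ℝ) • g)
    (ha : s ≤ a) (hb : s ≤ b) :
    polyD (Matrix.fromBlocks Y₁ 0 0 Y₂) (transvectant X₁ Z₁ X₂ Z₂ f g s) = 0 := by
  unfold transvectant
  rw [weight_eq hf₀ hfZ, weight_eq hg₀ hgZ, polyD_fromBlocks, map_sum, map_sum]
  simp only [Derivation.map_smul, polyD_leftBlock_mul, polyD_rightBlock_mul]
  -- The ends vanish as `f` and `g` are invariant. After the shift, the left term `j + 1` and the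
  -- right term `j` are multiples of the same product `(𝒴 ^ j f)(𝒴 ^ (s-j-1) g)` and cancel.
  rw [Finset.sum_range_succ', Finset.sum_range_succ]
  simp only [Function.iterate_zero, id, hfY, Nat.sub_self, hgY, map_zero, zero_mul, mul_zero,
    smul_zero, add_zero]
  rw [← Finset.sum_add_distrib]
  refine Finset.sum_eq_zero fun j hj => ?_
  have hj : j < s := Finset.mem_range.mp hj
  obtain ⟨n, rfl⟩ : ∃ n, s = j + n + 1 := ⟨s - j - 1, by omega⟩
  rw [h₁.Y_iterate_X hfY hfZ, show j + n + 1 - (j + 1) = n by omega,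
    show j + n + 1 - j = n + 1 by omega, h₂.Y_iterate_X hgY hgZ, map_smul, map_smul,
    smul_mul_assoc, mul_smul_comm, smul_smul, smul_smul, ← add_smul]
  have := transvectantCoeff_succ hj ha hb
  push_cast at this
  have h0 : (-1 : ℝ) ^ (j + 1) * transvectantCoeff a b (j + n + 1) (j + 1) * ((j + 1) * (a - j)) +
      (-1) ^ j * transvectantCoeff a b (j + n + 1) j * ((n + 1) * (b - n)) = 0 := by
    rw [pow_succ]
    linear_combination (-1 : ℝ) ^ j * (-1) * this
  rw [h0, zero_smul]

/-- The leading term of the transvectant: `𝒳₂ ^ s (f, g)^{(s)}` is a positive multiple of `f g`. -/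
theorem iterate_polyD_transvectant (h₂ : IsTriad X₂ Y₂ Z₂)
    (hf₀ : f ≠ 0) {a : ℕ} (hfZ : polyD Z₁ f = (a : ℝ) • f)
    (hg₀ : g ≠ 0) (hgY : polyD Y₂ g = 0) {b : ℕ} (hgZ : polyD Z₂ g = (b : ℝ) • g) (hb : s ≤ b) :
    ∃ c : ℝ, 0 < c ∧ (polyD (rightBlock Y₂))^[s] (transvectant X₁ Z₁ X₂ Z₂ f g s) =
      c • (rename Sum.inl f * rename Sum.inr g) := by
  obtain ⟨c, hc, hcg⟩ := h₂.iterate_Y_iterate_X hgY hgZ s hb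
  refine ⟨transvectantCoeff a b s 0 * c, mul_pos (transvectantCoeff_zero_pos _ _ _) hc, ?_⟩
  unfold transvectant
  rw [weight_eq hf₀ hfZ, weight_eq hg₀ hgZ, iterate_derivation_sum, Finset.sum_range_succ',
    Finset.sum_eq_zero, zero_add, iterate_derivation_smul, iterate_polyD_rightBlock_mul]
  · simp only [Nat.sub_zero, hcg, Function.iterate_zero, id, map_smul, mul_smul_comm, smul_smul,
      pow_zero, one_mul]
  -- Only the term with no `𝒴` on `f` survives: the others carry fewer than `s` powers of `𝒴` on
  -- `g`, so `𝒳₂ ^ s` kills them.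
  · intro j hj
    have hj : j < s := Finset.mem_range.mp hj
    obtain ⟨c', -, hc'⟩ := h₂.iterate_Y_iterate_X hgY hgZ (s - (j + 1)) (by omega)
    have hz : (polyD Y₂)^[s] ((polyD X₂)^[s - (j + 1)] g) = 0 := by
      apply iterate_derivation_eq_zero_of_le _ (show s - (j + 1) + 1 ≤ s by omega)
      rw [Function.iterate_succ_apply', hc', Derivation.map_smul, hgY, smul_zero]
    rw [iterate_derivation_smul, iterate_polyD_rightBlock_mul, hz, map_zero, mul_zero, smul_zero]

end Transvectant

/-! ### Combinatorics of the transvectant cone. -/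

section Cone

variable {p q : ℕ} {a : Fin p → ℕ} {b : Fin q → ℕ}

theorem add_mem_cone {u v : IntVec p q} (hu : u ∈ cone a b) (hv : v ∈ cone a b) :
    u + v ∈ cone a b := by
  obtain ⟨hu₁, hu₂⟩ := hu
  obtain ⟨hv₁, hv₂⟩ := hv
  constructor
  · simpa [mul_add, Finset.sum_add_distrib] using add_le_add hu₁ hv₁
  · simpa [mul_add, Finset.sum_add_distrib] using add_le_add hu₂ hv₂

variable (a b) in
/-- The transvectant cone as a monoid. -/
def coneMonoid : AddSubmonoid (IntVec p q) where
  carrier := cone a b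
  add_mem' := add_mem_cone
  zero_mem' := ⟨Nat.zero_le _, Nat.zero_le _⟩

theorem sum_mem_cone {t : ℕ} {π : Fin t → IntVec p q} (hπ : ∀ i, π i ∈ cone a b)
    (s : Finset (Fin t)) (K : Fin t → ℕ) : ∑ i ∈ s, K i • π i ∈ cone a b :=
  (coneMonoid a b).sum_mem fun i _ => (coneMonoid a b).nsmul_mem (hπ i) (K i)

/-- The sum of the entries. -/
def vecSize : IntVec p q →+ ℕ where
  toFun v := v.1.degree + v.2.1.degree + v.2.2
  map_zero' := by simp
  map_add' u v := by
    simp only [Prod.fst_add, Prod.snd_add, map_add]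
    omega

theorem vecSize_eq_zero {v : IntVec p q} : vecSize v = 0 ↔ v = 0 := by
  obtain ⟨k, l, s⟩ := v
  change k.degree + l.degree + s = 0 ↔ _
  rw [Nat.add_eq_zero_iff, Nat.add_eq_zero_iff, Finsupp.degree_eq_zero_iff,
    Finsupp.degree_eq_zero_iff]
  simp [Prod.ext_iff, and_assoc]

theorem vecSize_pos {v : IntVec p q} (hv : v ≠ 0) : 0 < vecSize v :=
  Nat.pos_of_ne_zero (mt vecSize_eq_zero.mp hv)

variable (a b) in
-- Dickson's lemma, applied to the entries together with the slacks of the two inequalities. If one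
-- extended vector dominates another, the difference is again in the cone, so the larger one is not
-- prime.
theorem finite_primes : (primes a b).Finite := by
  by_contra hinf
  let f := Set.Infinite.natEmbedding _ hinf
  let slack : IntVec p q → (Fin p → ℕ) × (Fin q → ℕ) × ℕ × ℕ × ℕ := fun v =>
    (v.1, v.2.1, v.2.2, ∑ i, a i * v.1 i - v.2.2, ∑ j, b j * v.2.1 j - v.2.2)
  obtain ⟨m, n, hmn, hle⟩ := wellQuasiOrdered_le (fun n => slack (f n))
  obtain ⟨⟨hm₁, hm₂⟩, hm0, -⟩ := (f m).2
  obtain ⟨⟨hn₁, hn₂⟩, -, hn⟩ := (f n).2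
  obtain ⟨h₁, h₂, h₃, h₄, h₅⟩ := hle
  have hle' : (f m : IntVec p q) ≤ f n := ⟨h₁, h₂, h₃⟩
  obtain ⟨w, hw⟩ := exists_add_of_le hle'
  have hwc : w ∈ cone a b := by
    simp only [slack, hw, Prod.fst_add, Prod.snd_add, Finsupp.add_apply, mul_add,
      Finset.sum_add_distrib] at h₄ h₅ hn₁ hn₂
    constructor <;> omega
  rcases hn _ (f m).2.1 w hwc hw with h | h
  · exact hm0 h
  · rw [h, add_zero] at hw
    exact hmn.ne' (f.injective (Subtype.ext hw))

variable {A₁ : Set (Fin p →₀ ℕ)} {A₂ : Set (Fin q →₀ ℕ)}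

theorem admissible_of_le (hA₁ : ∀ k ∈ A₁, ∀ l ≤ k, l ∈ A₁) (hA₂ : ∀ k ∈ A₂, ∀ l ≤ k, l ∈ A₂)
    {u v : IntVec p q} (hv : v ∈ admissible a b A₁ A₂) (hu : u ∈ cone a b) (huv : u ≤ v) :
    u ∈ admissible a b A₁ A₂ :=
  ⟨hu, hA₁ _ hv.2.1 _ huv.1, hA₂ _ hv.2.2 _ huv.2.1⟩

variable {t : ℕ} {π : Fin t → IntVec p q}

/-- Split until prime, with decreasing size. All factors stay admissible because `A₁` and `A₂` are
closed under divisors. -/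
theorem exists_factorization (hA₁ : ∀ k ∈ A₁, ∀ l ≤ k, l ∈ A₁)
    (hA₂ : ∀ k ∈ A₂, ∀ l ≤ k, l ∈ A₂) (hπ : Set.range π = admissiblePrimes a b A₁ A₂) :
    ∀ v ∈ admissible a b A₁ A₂, ∃ K : Fin t →₀ ℕ, v = ∑ i, K i • π i := by
  suffices ∀ (n : ℕ) (v : IntVec p q), vecSize v = n → v ∈ admissible a b A₁ A₂ →
      ∃ K : Fin t →₀ ℕ, v = ∑ i, K i • π i from fun v => this _ v rfl
  intro n
  induction n using Nat.strong_induction_on with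
  | _ n ih =>
    rintro v rfl hv
    by_cases h0 : v = 0
    · exact ⟨0, by simp [h0]⟩
    by_cases hp : v ∈ primes a b
    · obtain ⟨i, rfl⟩ : v ∈ Set.range π := hπ ▸ ⟨hp, hv⟩
      refine ⟨Finsupp.single i 1, ?_⟩
      rw [Finset.sum_eq_single i]
      · simp
      · intro j _ hj
        rw [Finsupp.single_eq_of_ne hj, zero_smul]
      · simp
    · have : ∃ u ∈ cone a b, ∃ w ∈ cone a b, v = u + w ∧ u ≠ 0 ∧ w ≠ 0 := by
        by_contra! hcon
        exact hp ⟨hv.1, h0, fun u hu w hw huw => or_iff_not_imp_left.mpr (hcon u hu w hw huw)⟩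
      obtain ⟨u, hu, w, hw, rfl, hu0, hw0⟩ := this
      rw [map_add] at ih
      have hu1 := vecSize_pos hu0
      have hw1 := vecSize_pos hw0
      obtain ⟨K, hK⟩ := ih _ (by omega) u rfl (admissible_of_le hA₁ hA₂ hv hu le_self_add)
      obtain ⟨L, hL⟩ := ih _ (by omega) w rfl (admissible_of_le hA₁ hA₂ hv hw le_add_self)
      refine ⟨K + L, ?_⟩
      rw [hK, hL]
      simp [add_smul, Finset.sum_add_distrib]

theorem sum_eq_sum_Iio_add_sum_Ioi {M : Type*} [AddCommMonoid M] (f : Fin t → M) (j : Fin t) :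
    ∑ i, f i = ∑ i ∈ Finset.Iio j, f i + f j + ∑ i ∈ Finset.Ioi j, f i := by
  have h : (Finset.univ : Finset (Fin t)) = (Finset.Iio j ∪ {j}) ∪ Finset.Ioi j := by
    ext i
    simp [le_or_gt]
  rw [h, Finset.sum_union, Finset.sum_union, Finset.sum_singleton]
  · simp
  · rw [Finset.disjoint_left]
    intro i hi hi'
    simp only [Finset.mem_union, Finset.mem_Iio, Finset.mem_singleton, Finset.mem_Ioi] at hi hi'
    rcases hi with hi | rfl
    · exact lt_asymm hi hi'
    · exact lt_irrefl _ hi'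

/-- Every admissible vector has a greedy factorization: the lexicographically largest one. -/
theorem exists_isGreedy (hA₁ : ∀ k ∈ A₁, ∀ l ≤ k, l ∈ A₁)
    (hA₂ : ∀ k ∈ A₂, ∀ l ≤ k, l ∈ A₂) (hπ : Set.range π = admissiblePrimes a b A₁ A₂)
    {v : IntVec p q} (hv : v ∈ admissible a b A₁ A₂) : ∃ K, IsGreedy a b π v K := by
  have hπ' : ∀ i, π i ∈ admissiblePrimes a b A₁ A₂ := fun i => hπ ▸ Set.mem_range_self i
  have hcone : ∀ i, π i ∈ cone a b := fun i => (hπ' i).1.1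
  let S : Set (Fin t →₀ ℕ) := {K | v = ∑ i, K i • π i}
  have hS : S.Finite := by
    refine (Finsupp.finite_of_degree_le (σ := Fin t) (vecSize v)).subset fun K hK => ?_
    have hK : v = ∑ i, K i • π i := hK
    change K.degree ≤ vecSize v
    rw [hK, map_sum, Finsupp.degree_eq_sum]
    refine Finset.sum_le_sum fun i _ => ?_
    rw [map_nsmul, smul_eq_mul]
    exact Nat.le_mul_of_pos_right _ (vecSize_pos (hπ' i).1.2.1)
  -- If `c > K j` copies of `π j` could be taken out, the remainder `u` would be admissible and have
  -- a factorization `L`. Then `M + L`, with `M` equal to `K` before `j` and to `c` at `j`, would be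
  -- a lexicographically larger factorization of `v`.
  obtain ⟨K, hK, hmax⟩ := Set.exists_max_image S (fun K => toLex (K : Fin t → ℕ)) hS
    (exists_factorization hA₁ hA₂ hπ v hv)
  have hK : v = ∑ i, K i • π i := hK
  refine ⟨K, hK, fun j => ⟨⟨_, sum_mem_cone hcone (Finset.Ioi j) K, ?_⟩, ?_⟩⟩
  · rw [← sum_eq_sum_Iio_add_sum_Ioi fun i => K i • π i]
    exact hK
  · rintro c ⟨u, hu, hvu⟩
    by_contra! hc
    obtain ⟨L, hL⟩ := exists_factorization hA₁ hA₂ hπ u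
      (admissible_of_le hA₁ hA₂ hv hu (hvu ▸ le_add_self))
    let M : Fin t → ℕ := fun i => if i < j then K i else if i = j then c else 0
    have hM : ∑ i, M i • π i = ∑ i ∈ Finset.Iio j, K i • π i + c • π j := by
      rw [sum_eq_sum_Iio_add_sum_Ioi _ j, Finset.sum_eq_zero (s := Finset.Ioi j), add_zero]
      · congr 1
        · refine Finset.sum_congr rfl fun i hi => ?_
          simp [M, Finset.mem_Iio.mp hi]
        · simp [M]
      · intro i hi
        have hi := Finset.mem_Ioi.mp hi
        simp [M, hi.not_gt, hi.ne']
    have hN : (Finsupp.equivFunOnFinite.symm M + L) ∈ S := by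
      change v = _
      simp only [Finsupp.add_apply, add_smul, Finset.sum_add_distrib,
        Finsupp.equivFunOnFinite_symm_apply_apply, hM, ← hL]
      exact hvu
    have h1 := hmax _ hN
    have h2 : toLex (K : Fin t → ℕ) < toLex M := by
      refine ⟨j, fun i hi => ?_, ?_⟩
      · simp [M, hi]
      · simpa [M] using hc
    have h3 : toLex M ≤ toLex ((Finsupp.equivFunOnFinite.symm M + L : Fin t →₀ ℕ) : Fin t → ℕ) := by
      apply Pi.toLex_monotone
      intro i
      simp
    exact absurd (h2.trans_le (h3.trans h1)) (lt_irrefl _)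

theorem IsGreedy.unique {v : IntVec p q} {K L : Fin t →₀ ℕ} (hK : IsGreedy a b π v K)
    (hL : IsGreedy a b π v L) : K = L := by
  have h : ∀ (n : ℕ) (j : Fin t), (j : ℕ) = n → K j = L j := by
    intro n
    induction n using Nat.strong_induction_on with
    | _ n ih =>
      rintro j rfl
      have hs : ∑ i ∈ Finset.Iio j, K i • π i = ∑ i ∈ Finset.Iio j, L i • π i :=
        Finset.sum_congr rfl fun i hi => by rw [ih i (Fin.lt_def.mp (Finset.mem_Iio.mp hi)) i rfl]
      have hKj := hK.greatest j
      rw [hs] at hKj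
      exact hKj.unique (hL.greatest j)
  exact Finsupp.ext fun j => h _ j rfl

/-- If `L` left room for further copies of `π j`, putting back the factors of `K - L` would leave
room for them in `K` as well. -/
theorem IsGreedy.of_le (hπ : ∀ i, π i ∈ cone a b) {v : IntVec p q} {K L : Fin t →₀ ℕ}
    (hK : IsGreedy a b π v K) (hL : L ≤ K) : IsGreedy a b π (∑ i, L i • π i) L := by
  obtain ⟨M, rfl⟩ := exists_add_of_le hL
  refine ⟨rfl, fun j => ⟨⟨_, sum_mem_cone hπ (Finset.Ioi j) L, ?_⟩, ?_⟩⟩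
  · exact sum_eq_sum_Iio_add_sum_Ioi _ j
  · rintro c ⟨u, hu, hcu⟩
    have h := @(hK.greatest j).2 (c + M j)
      ⟨u + ∑ i ∈ Finset.Ioi j, M i • π i, add_mem_cone hu (sum_mem_cone hπ _ M), ?_⟩
    · rw [Finsupp.add_apply] at h
      omega
    · have hv := hK.complete
      simp only [Finsupp.add_apply, add_smul, Finset.sum_add_distrib] at hv ⊢
      rw [hv, hcu, sum_eq_sum_Iio_add_sum_Ioi (fun i => M i • π i) j]
      abel

end Cone

/-- A family is linearly independent if it is triangular with linearly independent leading terms: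
`L s` extracts the leading term of the members of level `s` and kills the lower levels. -/
theorem linearIndependent_of_leadingTerm {K M N : Type*} [AddCommGroup M] [Module ℝ M]
    [AddCommGroup N] [Module ℝ N] {e : K → M} {level : K → ℕ} {L : ℕ → M →ₗ[ℝ] N} {lead : K → N}
    (hlead : ∀ k, ∃ c : ℝ, c ≠ 0 ∧ L (level k) (e k) = c • lead k)
    (hlow : ∀ k n, level k < n → L n (e k) = 0)
    (hli : ∀ n, LinearIndepOn ℝ lead {k | level k = n}) : LinearIndependent ℝ e := by
  classical
  choose c hc0 hc using hlead
  rw [linearIndependent_iff']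
  intro S g hg
  by_contra! hne
  obtain ⟨k₁, hk₁S, hk₁⟩ := hne
  -- At the highest level with a nonzero coefficient, `L` kills everything below and leaves a
  -- relation among leading terms of one level.
  obtain ⟨k₀, hk₀, hmax⟩ := Finset.exists_max_image (S.filter fun k => g k ≠ 0) level
    ⟨k₁, Finset.mem_filter.mpr ⟨hk₁S, hk₁⟩⟩
  obtain ⟨hk₀S, hk₀0⟩ := Finset.mem_filter.mp hk₀
  have h1 : ∑ k ∈ S.filter (fun k => level k = level k₀), (g k * c k) • lead k = 0 := by
    have h0 : ∑ k ∈ S, L (level k₀) (g k • e k) = 0 := by rw [← map_sum, hg, map_zero]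
    rw [Finset.sum_filter]
    refine Eq.trans ?_ h0
    refine Finset.sum_congr rfl fun k hk => ?_
    rw [map_smul]
    split_ifs with hl
    · rw [← hl, hc, smul_smul]
    · by_cases hk0 : g k = 0
      · rw [hk0, zero_smul]
      · rw [hlow k _ (lt_of_le_of_ne (hmax k (Finset.mem_filter.mpr ⟨hk, hk0⟩)) hl), smul_zero]
  have h2 := linearIndepOn_iff'.mp (hli (level k₀)) _ _
    (fun k hk => (Finset.mem_filter.mp hk).2) h1 k₀ (Finset.mem_filter.mpr ⟨hk₀S, rfl⟩)
  exact mul_ne_zero hk₀0 (hc0 k₀) h2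

/-! ### Leading terms, independence and spanning in the product ring. -/

section Product

variable {ι κ : Type*} {p q : ℕ}

/-- The product `α ^ k β ^ ℓ`, the leading term of the transvectant `[k; ℓ; s]`. -/
def leadingProduct (α : Fin p → MvPolynomial ι ℝ) (β : Fin q → MvPolynomial κ ℝ)
    (v : IntVec p q) : MvPolynomial (ι ⊕ κ) ℝ :=
  rename Sum.inl (mon α v.1) * rename Sum.inr (mon β v.2.1)

theorem leadingProduct_ne_zero {α : Fin p → MvPolynomial ι ℝ} {β : Fin q → MvPolynomial κ ℝ}
    (hα : ∀ i, α i ≠ 0) (hβ : ∀ j, β j ≠ 0) (v : IntVec p q) : leadingProduct α β v ≠ 0 := by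
  refine mul_ne_zero ?_ ?_
  · exact (map_ne_zero_iff _ (rename_injective _ Sum.inl_injective)).mpr (mon_ne_zero hα _)
  · exact (map_ne_zero_iff _ (rename_injective _ Sum.inr_injective)).mpr (mon_ne_zero hβ _)

theorem leadingProduct_add (α : Fin p → MvPolynomial ι ℝ) (β : Fin q → MvPolynomial κ ℝ)
    (u v : IntVec p q) :
    leadingProduct α β (u + v) = leadingProduct α β u * leadingProduct α β v := by
  simp only [leadingProduct, Prod.fst_add, Prod.snd_add, mon_add, map_mul]
  ring

theorem linearIndependent_leadingProduct {α : Fin p → MvPolynomial ι ℝ}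
    {β : Fin q → MvPolynomial κ ℝ} {A₁ : Set (Fin p →₀ ℕ)} {A₂ : Set (Fin q →₀ ℕ)}
    (hA₁ : LinearIndependent ℝ fun k : A₁ => mon α (k : Fin p →₀ ℕ))
    (hA₂ : LinearIndependent ℝ fun k : A₂ => mon β (k : Fin q →₀ ℕ)) {K : Type*}
    {v : K → IntVec p q} (hv : Function.Injective v)
    (hvA : ∀ k, (v k).1 ∈ A₁ ∧ (v k).2.1 ∈ A₂) (n : ℕ) :
    LinearIndepOn ℝ (fun k => leadingProduct α β (v k)) {k | (v k).2.2 = n} := by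
  have h := linearIndependent_inl_mul_inr hA₁ hA₂
  refine h.comp (fun k : {k | (v k).2.2 = n} =>
    ((⟨(v k).1, (hvA k).1⟩ : A₁), (⟨(v k).2.1, (hvA k).2⟩ : A₂))) ?_
  rintro ⟨k, hk⟩ ⟨l, hl⟩ hkl
  have h1 := congrArg (fun x : A₁ × A₂ => (x.1 : Fin p →₀ ℕ)) hkl
  have h2 := congrArg (fun x : A₁ × A₂ => (x.2 : Fin q →₀ ℕ)) hkl
  exact Subtype.ext (hv (Prod.ext h1 (Prod.ext h2 (hk.trans hl.symm))))

variable [Fintype ι] [Fintype κ]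

/-- `h` has the leading term of the transvectant of `v`. -/
def HasLeadingTerm (Y₂ : Matrix κ κ ℝ) (α : Fin p → MvPolynomial ι ℝ)
    (β : Fin q → MvPolynomial κ ℝ) (v : IntVec p q) (h : MvPolynomial (ι ⊕ κ) ℝ) : Prop :=
  ∃ c : ℝ, 0 < c ∧ (polyD (rightBlock Y₂))^[v.2.2] h = c • leadingProduct α β v

variable {X₁ Y₁ Z₁ : Matrix ι ι ℝ} {X₂ Y₂ Z₂ : Matrix κ κ ℝ}
  {α : Fin p → MvPolynomial ι ℝ} {β : Fin q → MvPolynomial κ ℝ}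

theorem polyD_rightBlock_leadingProduct (hβ : ∀ j, β j ∈ polyInvariants Y₂) (v : IntVec p q) :
    polyD (rightBlock Y₂) (leadingProduct α β v) = 0 := by
  have : polyD Y₂ (mon β v.2.1) = 0 := mon_mem_polyInvariants hβ _
  rw [leadingProduct, polyD_rightBlock_mul, this, map_zero, mul_zero]

theorem HasLeadingTerm.iterate_eq_zero (hβ : ∀ j, β j ∈ polyInvariants Y₂) {v : IntVec p q}
    {h : MvPolynomial (ι ⊕ κ) ℝ} (hh : HasLeadingTerm Y₂ α β v h) {n : ℕ} (hn : v.2.2 < n) :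
    (polyD (rightBlock Y₂))^[n] h = 0 := by
  obtain ⟨c, -, hc⟩ := hh
  apply iterate_derivation_eq_zero_of_le _ (Nat.succ_le_of_lt hn)
  rw [Function.iterate_succ_apply', hc, Derivation.map_smul, polyD_rightBlock_leadingProduct hβ,
    smul_zero]

/-- In Leibniz' rule for `𝒳₂ ^ (s + s')` every term but one has too many derivatives on a factor.
The binomial coefficient that remains is positive. -/
theorem HasLeadingTerm.mul (hβ : ∀ j, β j ∈ polyInvariants Y₂) {u v : IntVec p q}
    {h k : MvPolynomial (ι ⊕ κ) ℝ} (hh : HasLeadingTerm Y₂ α β u h)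
    (hk : HasLeadingTerm Y₂ α β v k) : HasLeadingTerm Y₂ α β (u + v) (h * k) := by
  have hh' := hh.iterate_eq_zero hβ (Nat.lt_succ_self _)
  have hk' := hk.iterate_eq_zero hβ (Nat.lt_succ_self _)
  obtain ⟨c, hc, hch⟩ := hh
  obtain ⟨d, hd, hdk⟩ := hk
  refine ⟨((u + v).2.2.choose u.2.2) * (c * d), ?_, ?_⟩
  · have : 0 < (u + v).2.2.choose u.2.2 := Nat.choose_pos (Nat.le_add_right _ _)
    positivity
  · rw [iterate_derivation_mul_top _ (u + v).2.2 u.2.2 v.2.2 rfl h k hh' hk', hch, hdk,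
      leadingProduct_add, smul_mul_smul_comm, smul_smul]

theorem hasLeadingTerm_one : HasLeadingTerm Y₂ α β 0 1 :=
  ⟨1, one_pos, by simp [leadingProduct, mon_zero]⟩

theorem HasLeadingTerm.mon (hβ : ∀ j, β j ∈ polyInvariants Y₂) {t : ℕ} {π : Fin t → IntVec p q}
    {θ : Fin t → MvPolynomial (ι ⊕ κ) ℝ} (hθ : ∀ i, HasLeadingTerm Y₂ α β (π i) (θ i))
    (K : Fin t →₀ ℕ) : HasLeadingTerm Y₂ α β (∑ i, K i • π i) (mon θ K) := by
  classical
  have hpow : ∀ i (n : ℕ), HasLeadingTerm Y₂ α β (n • π i) (θ i ^ n) := by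
    intro i n
    induction n with
    | zero => simpa using hasLeadingTerm_one
    | succ n ih =>
      rw [succ_nsmul, pow_succ]
      exact ih.mul hβ (hθ i)
  have hs : ∀ s : Finset (Fin t),
      HasLeadingTerm Y₂ α β (∑ i ∈ s, K i • π i) (∏ i ∈ s, θ i ^ K i) := by
    intro s
    induction s using Finset.induction_on with
    | empty => exact hasLeadingTerm_one
    | insert i s hi ih =>
      rw [Finset.sum_insert hi, Finset.prod_insert hi]
      exact (hpow i (K i)).mul hβ ih
  exact hs _

variable {A₁ : Set (Fin p →₀ ℕ)} {A₂ : Set (Fin q →₀ ℕ)}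

theorem linearIndependent_of_hasLeadingTerm (hβ : ∀ j, β j ∈ polyInvariants Y₂)
    (hA₁ : LinearIndependent ℝ fun k : A₁ => mon α (k : Fin p →₀ ℕ))
    (hA₂ : LinearIndependent ℝ fun k : A₂ => mon β (k : Fin q →₀ ℕ)) {K : Type*}
    {v : K → IntVec p q} (hv : Function.Injective v)
    (hvA : ∀ k, (v k).1 ∈ A₁ ∧ (v k).2.1 ∈ A₂) {e : K → MvPolynomial (ι ⊕ κ) ℝ}
    (he : ∀ k, HasLeadingTerm Y₂ α β (v k) (e k)) : LinearIndependent ℝ e := by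
  let D : Module.End ℝ (MvPolynomial (ι ⊕ κ) ℝ) :=
    (polyD (rightBlock Y₂) : Derivation ℝ (MvPolynomial (ι ⊕ κ) ℝ) (MvPolynomial (ι ⊕ κ) ℝ))
  refine linearIndependent_of_leadingTerm (level := fun k => (v k).2.2) (L := fun n => D ^ n)
    (lead := fun k => leadingProduct α β (v k)) (fun k => ?_) (fun k n hn => ?_)
    (linearIndependent_leadingProduct hA₁ hA₂ hv hvA)
  · obtain ⟨c, hc, h⟩ := he k
    exact ⟨c, hc.ne', (iterate_derivation_eq_pow _ _ _).symm.trans h⟩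
  · exact (iterate_derivation_eq_pow _ _ _).symm.trans ((he k).iterate_eq_zero hβ hn)

theorem iterate_leftBlock_of_invariant {h : MvPolynomial (ι ⊕ κ) ℝ}
    (hh : h ∈ polyInvariants (Matrix.fromBlocks Y₁ 0 0 Y₂)) (n : ℕ) :
    (polyD (leftBlock Y₁))^[n] h = (-1 : ℝ) ^ n • (polyD (rightBlock Y₂))^[n] h := by
  have h1 : polyD (leftBlock Y₁) h = -polyD (rightBlock Y₂) h := by
    rw [eq_neg_iff_add_eq_zero, ← polyD_fromBlocks]
    exact hh
  have hcomm : Function.Commute (polyD (leftBlock Y₁ : Matrix (ι ⊕ κ) (ι ⊕ κ) ℝ))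
    (polyD (rightBlock Y₂)) := polyD_leftBlock_rightBlock_comm Y₁ Y₂
  induction n with
  | zero => simp
  | succ n ih =>
    rw [Function.iterate_succ_apply', ih, Derivation.map_smul, hcomm.iterate_right n h, h1,
      ← neg_one_smul ℝ (polyD (rightBlock Y₂) h), iterate_derivation_smul, smul_smul, pow_succ,
      Function.iterate_succ_apply]

/-- A family of invariants that realizes all admissible leading terms spans the invariants. -/
theorem mem_span_of_hasLeadingTerm (h₁ : IsBoxData X₁ Y₁ Z₁ α A₁) (h₂ : IsBoxData X₂ Y₂ Z₂ β A₂)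
    {K : Type*} {e : K → MvPolynomial (ι ⊕ κ) ℝ}
    (heY : ∀ k, e k ∈ polyInvariants (Matrix.fromBlocks Y₁ 0 0 Y₂))
    (he : ∀ v ∈ admissible (weights Z₁ α) (weights Z₂ β) A₁ A₂,
      ∃ k, HasLeadingTerm Y₂ α β v (e k))
    {h : MvPolynomial (ι ⊕ κ) ℝ} (hh : h ∈ polyInvariants (Matrix.fromBlocks Y₁ 0 0 Y₂)) :
    h ∈ Submodule.span ℝ (Set.range e) := by
  have hα := h₁.hilbertBasis.weightInvariant
  have hβ := h₂.hilbertBasis.weightInvariant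
  have hli := linearIndependent_inl_mul_inr h₁.preferred.linearIndependent
    h₂.preferred.linearIndependent
  suffices ∀ (n : ℕ) (h : MvPolynomial (ι ⊕ κ) ℝ),
      h ∈ polyInvariants (Matrix.fromBlocks Y₁ 0 0 Y₂) →
      (polyD (rightBlock Y₂))^[n] h = 0 → h ∈ Submodule.span ℝ (Set.range e) by
    obtain ⟨N, hN⟩ := (h₂.triad.rightBlock (ι := ι)).exists_iterate_Y_eq_zero_of_totalDegree_le
      h.totalDegree
    exact this N h hh (hN h le_rfl)
  intro n
  induction n with
  | zero =>
    intro h _ h0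
    obtain rfl : h = 0 := h0
    exact Submodule.zero_mem _
  | succ n ih =>
    intro h hh h0
    have hr : polyD (rightBlock Y₂) ((polyD (rightBlock Y₂))^[n] h) = 0 := by
      rw [← Function.iterate_succ_apply' (polyD (rightBlock Y₂))]
      exact h0
    have hl0 : (polyD (leftBlock Y₁))^[n + 1] h = 0 := by
      rw [iterate_leftBlock_of_invariant hh, h0, smul_zero]
    have hl : polyD (leftBlock Y₁) ((polyD (rightBlock Y₂))^[n] h) = 0 := by
      -- `𝒳₂ ^ n h` equals `𝒳₁ ^ n h` up to sign, so `𝒳₁` kills it too.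
      have hpm : (polyD (rightBlock Y₂))^[n] h = (-1 : ℝ) ^ n • (polyD (leftBlock Y₁))^[n] h := by
        rw [iterate_leftBlock_of_invariant hh, smul_smul, ← mul_pow]
        simp
      rw [hpm, Derivation.map_smul, ← Function.iterate_succ_apply' (polyD (leftBlock Y₁)), hl0,
        smul_zero]
    obtain ⟨c, hc⟩ := Finsupp.mem_span_range_iff_exists_finsupp.mp
      (mem_span_of_left_right_invariant
        (fun f hf =>
          h₁.preferred.mem_span (fun i => (hα i).homogeneous) (fun i => (hα i).ne_zero) hf)
        (fun f hf =>
          h₂.preferred.mem_span (fun i => (hβ i).homogeneous) (fun i => (hβ i).ne_zero) hf)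
        hl hr)
    -- The weight lemma for the left factor, applied to `𝒳₁ ^ n h`, and for the right factor,
    -- applied to `𝒳₂ ^ n h`, gives the two inequalities of the cone.
    have hadm : ∀ kl ∈ c.support, ((kl.1, kl.2, n) : IntVec p q) ∈
        admissible (weights Z₁ α) (weights Z₂ β) A₁ A₂ := by
      intro kl hkl
      have hne := Finsupp.mem_support_iff.mp hkl
      refine ⟨⟨?_, ?_⟩, kl.1.2, kl.2.2⟩
      · obtain ⟨m, hm⟩ := (h₁.triad.leftBlock (κ := κ)).weight_of_mem_image hli
          (w := fun kl => ((∑ i, weights Z₁ α i * (kl.1 : Fin p →₀ ℕ) i : ℕ) : ℝ))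
          (fun kl => by
            rw [polyD_leftBlock_mul, h₁.triad.polyD_Z_mon hα, map_smul, smul_mul_assoc])
          hl0 c.support (fun kl => (-1 : ℝ) ^ n * c kl)
          (by
            rw [iterate_leftBlock_of_invariant hh, ← hc, Finsupp.sum, Finset.smul_sum]
            simp only [smul_smul])
          hkl (mul_ne_zero (pow_ne_zero _ (by norm_num)) hne)
        have := Nat.cast_injective hm
        exact this ▸ Nat.le_add_right n m
      · obtain ⟨m, hm⟩ := (h₂.triad.rightBlock (ι := ι)).weight_of_mem_image hli
          (w := fun kl => ((∑ i, weights Z₂ β i * (kl.2 : Fin q →₀ ℕ) i : ℕ) : ℝ))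
          (fun kl => by
            rw [polyD_rightBlock_mul, h₂.triad.polyD_Z_mon hβ, map_smul, mul_smul_comm])
          h0 c.support c hc.symm hkl hne
        have := Nat.cast_injective hm
        exact this ▸ Nat.le_add_right n m
    have hlead : ∀ kl : A₁ × A₂, ∃ g ∈ Submodule.span ℝ (Set.range e),
        g ∈ polyInvariants (Matrix.fromBlocks Y₁ 0 0 Y₂) ∧ (kl ∈ c.support →
        (polyD (rightBlock Y₂))^[n] g = leadingProduct α β (kl.1, kl.2, n)) := by
      intro kl
      by_cases hkl : kl ∈ c.support
      · obtain ⟨k, a, ha, hk⟩ := he _ (hadm kl hkl)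
        refine ⟨a⁻¹ • e k, Submodule.smul_mem _ _ (Submodule.subset_span ⟨k, rfl⟩), ?_, fun _ => ?_⟩
        · change polyD _ _ = 0
          rw [Derivation.map_smul, (heY k : polyD _ _ = 0), smul_zero]
        · rw [iterate_derivation_smul, hk, smul_smul, inv_mul_cancel₀ ha.ne', one_smul]
      · exact ⟨0, Submodule.zero_mem _, Derivation.map_zero _, fun h => absurd h hkl⟩
    choose g hg hgY hgl using hlead
    have hsum : ∑ kl ∈ c.support, c kl • g kl ∈ Submodule.span ℝ (Set.range e) :=
      Submodule.sum_mem _ fun kl _ => Submodule.smul_mem _ _ (hg kl)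
    rw [← sub_add_cancel h (∑ kl ∈ c.support, c kl • g kl)]
    refine Submodule.add_mem _ (ih _ ?_ ?_) hsum
    · change polyD _ _ = 0
      rw [Derivation.map_sub, (hh : polyD _ _ = 0), map_sum, Finset.sum_eq_zero, sub_zero]
      intro kl _
      rw [Derivation.map_smul, (hgY kl : polyD _ _ = 0), smul_zero]
    · rw [iterate_derivation_sub, iterate_derivation_sum, ← hc, Finsupp.sum,
        sub_eq_zero]
      refine Finset.sum_congr rfl fun kl hkl => ?_
      rw [iterate_derivation_smul, hgl kl hkl]
      rfl

theorem hasLeadingTerm_transvectantMap (h₁ : IsBoxData X₁ Y₁ Z₁ α A₁)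
    (h₂ : IsBoxData X₂ Y₂ Z₂ β A₂) {v : IntVec p q}
    (hv : v ∈ cone (weights Z₁ α) (weights Z₂ β)) :
    HasLeadingTerm Y₂ α β v (transvectantMap X₁ Z₁ X₂ Z₂ α β v) := by
  have hα := h₁.hilbertBasis.weightInvariant
  have hβ := h₂.hilbertBasis.weightInvariant
  exact iterate_polyD_transvectant h₂.triad (mon_ne_zero (fun i => (hα i).ne_zero) _)
    (h₁.triad.polyD_Z_mon hα _) (mon_ne_zero (fun i => (hβ i).ne_zero) _)
    (mon_mem_polyInvariants (fun i => (hβ i).invariant) _) (h₂.triad.polyD_Z_mon hβ _) hv.2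

theorem isHomogeneousWeightInvariant_transvectantMap (h₁ : IsBoxData X₁ Y₁ Z₁ α A₁)
    (h₂ : IsBoxData X₂ Y₂ Z₂ β A₂) {v : IntVec p q}
    (hv : v ∈ cone (weights Z₁ α) (weights Z₂ β)) :
    IsHomogeneousWeightInvariant (Matrix.fromBlocks Y₁ 0 0 Y₂) (Matrix.fromBlocks Z₁ 0 0 Z₂)
      (transvectantMap X₁ Z₁ X₂ Z₂ α β v) := by
  have hα := h₁.hilbertBasis.weightInvariant
  have hβ := h₂.hilbertBasis.weightInvariant
  refine ⟨?_, ?_, ?_, _, polyD_Z_transvectant h₁.triad h₂.triad (h₁.triad.polyD_Z_mon hα _)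
    (h₂.triad.polyD_Z_mon hβ _)⟩
  · intro h0
    obtain ⟨c, hc, h⟩ := hasLeadingTerm_transvectantMap h₁ h₂ hv
    rw [h0, iterate_derivation_zero] at h
    exact smul_ne_zero hc.ne' (leadingProduct_ne_zero (fun i => (hα i).ne_zero)
      (fun i => (hβ i).ne_zero) v) h.symm
  · choose d hd using fun i => (hα i).homogeneous
    choose d' hd' using fun i => (hβ i).homogeneous
    exact ⟨_, isHomogeneous_transvectant (mon_isHomogeneous hd _) (mon_isHomogeneous hd' _)⟩
  · exact polyD_Y_transvectant h₁.triad h₂.triad (mon_ne_zero (fun i => (hα i).ne_zero) _)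
      (mon_mem_polyInvariants (fun i => (hα i).invariant) _) (h₁.triad.polyD_Z_mon hα _)
      (mon_ne_zero (fun i => (hβ i).ne_zero) _)
      (mon_mem_polyInvariants (fun i => (hβ i).invariant) _) (h₂.triad.polyD_Z_mon hβ _) hv.1 hv.2

/-- The polynomial `δ` plays no role beyond its vector `v`, so the box product is a matter of the
cone alone. -/
theorem mem_boxProduct {t : ℕ} {π : Fin t → IntVec p q} {K : Fin t →₀ ℕ} :
    K ∈ boxProduct X₁ Z₁ X₂ Z₂ α β A₁ A₂ π ↔
      ∃ v ∈ admissible (weights Z₁ α) (weights Z₂ β) A₁ A₂,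
        IsGreedy (weights Z₁ α) (weights Z₂ β) π v K := by
  constructor
  · rintro ⟨_, -, v, hv, -, hK⟩
    exact ⟨v, hv, hK⟩
  · rintro ⟨v, hv, hK⟩
    exact ⟨_, ⟨v, hv, rfl⟩, v, hv, rfl, hK⟩

end Product

theorem mon_mem_range_aeval {R : Type*} [CommRing R] [Algebra ℝ R] {t : ℕ} (θ : Fin t → R)
    (K : Fin t →₀ ℕ) : mon θ K ∈ (aeval θ : MvPolynomial (Fin t) ℝ →ₐ[ℝ] R).range :=
  ⟨mon X K, by simp [mon]⟩

end BoxProduct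

end

/-! ### The theorem. -/

open BoxProduct

theorem theorem11p9 {ι κ : Type*} [Fintype ι] [Fintype κ]
    (X₁ Y₁ Z₁ : Matrix ι ι ℝ) (X₂ Y₂ Z₂ : Matrix κ κ ℝ) {p q : ℕ}
    (α : Fin p → MvPolynomial ι ℝ) (β : Fin q → MvPolynomial κ ℝ)
    (A₁ : Set (Fin p →₀ ℕ)) (A₂ : Set (Fin q →₀ ℕ))
    (h₁ : IsBoxData X₁ Y₁ Z₁ α A₁) (h₂ : IsBoxData X₂ Y₂ Z₂ β A₂) :
    (admissiblePrimes (weights Z₁ α) (weights Z₂ β) A₁ A₂).Finite ∧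
    ∀ (t : ℕ) (π : Fin t → IntVec p q), Function.Injective π →
      Set.range π = admissiblePrimes (weights Z₁ α) (weights Z₂ β) A₁ A₂ →
      IsBoxData (Matrix.fromBlocks X₁ 0 0 X₂) (Matrix.fromBlocks Y₁ 0 0 Y₂)
        (Matrix.fromBlocks Z₁ 0 0 Z₂)
        (fun i => transvectantMap X₁ Z₁ X₂ Z₂ α β (π i))
        (boxProduct X₁ Z₁ X₂ Z₂ α β A₁ A₂ π) ∧
      ∀ K ∈ boxProduct X₁ Z₁ X₂ Z₂ α β A₁ A₂ π, ∀ K' ≤ K,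
        K' ∈ boxProduct X₁ Z₁ X₂ Z₂ α β A₁ A₂ π := by
  refine ⟨(finite_primes _ _).subset Set.inter_subset_left, fun t π hπ hrange => ?_⟩
  have hA₁ := isStandard_iff.mp h₁.standard
  have hA₂ := isStandard_iff.mp h₂.standard
  have hli₁ := h₁.preferred.linearIndependent
  have hli₂ := h₂.preferred.linearIndependent
  have hβ := fun j => (h₂.hilbertBasis.weightInvariant j).invariant
  have hadm : ∀ i, π i ∈ admissible (weights Z₁ α) (weights Z₂ β) A₁ A₂ :=
    fun i => (hrange ▸ Set.mem_range_self i : π i ∈ admissiblePrimes _ _ A₁ A₂).2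
  set θ := fun i => transvectantMap X₁ Z₁ X₂ Z₂ α β (π i)
  have hθ : ∀ i, IsHomogeneousWeightInvariant (Matrix.fromBlocks Y₁ 0 0 Y₂)
      (Matrix.fromBlocks Z₁ 0 0 Z₂) (θ i) :=
    fun i => isHomogeneousWeightInvariant_transvectantMap h₁ h₂ (hadm i).1
  have hθlead : ∀ i, HasLeadingTerm Y₂ α β (π i) (θ i) :=
    fun i => hasLeadingTerm_transvectantMap h₁ h₂ (hadm i).1
  have hθinv : ∀ K, mon θ K ∈ polyInvariants (Matrix.fromBlocks Y₁ 0 0 Y₂) :=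
    mon_mem_polyInvariants fun i => (hθ i).invariant
  have hlead := HasLeadingTerm.mon hβ hθlead
  have hdown : ∀ K ∈ boxProduct X₁ Z₁ X₂ Z₂ α β A₁ A₂ π, ∀ K' ≤ K,
      K' ∈ boxProduct X₁ Z₁ X₂ Z₂ α β A₁ A₂ π := by
    intro K hK L hL
    obtain ⟨v, hv, hvK⟩ := mem_boxProduct.mp hK
    refine mem_boxProduct.mpr ⟨_, ?_, hvK.of_le (fun i => (hadm i).1) hL⟩
    refine admissible_of_le hA₁ hA₂ hv (sum_mem_cone (fun i => (hadm i).1) _ L) ?_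
    rw [hvK.complete]
    exact Finset.sum_le_sum fun i _ => nsmul_le_nsmul_left zero_le (hL i)
  have hspan : ∀ f ∈ polyInvariants (Matrix.fromBlocks Y₁ 0 0 Y₂), f ∈ Submodule.span ℝ
      (Set.range fun K : boxProduct X₁ Z₁ X₂ Z₂ α β A₁ A₂ π => mon θ (K : Fin t →₀ ℕ)) := by
    intro f hf
    refine mem_span_of_hasLeadingTerm h₁ h₂
      (e := fun K : boxProduct X₁ Z₁ X₂ Z₂ α β A₁ A₂ π => mon θ (K : Fin t →₀ ℕ))
      (fun K => hθinv K) (fun v hv => ?_) hf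
    -- The preferred factorization of `[v]` has the leading term of `[v]`.
    obtain ⟨K, hK⟩ := exists_isGreedy hA₁ hA₂ hrange hv
    refine ⟨⟨K, mem_boxProduct.mpr ⟨v, hv, hK⟩⟩, ?_⟩
    have := hlead K
    rwa [← hK.complete] at this
  refine ⟨⟨h₁.triad.fromBlocks h₂.triad, ⟨?_, hθ, fun f hf => ?_⟩, ⟨?_, ?_, ?_⟩,
    isStandard_iff.mpr hdown⟩, hdown⟩
  -- Distinct primes have distinct leading vectors, so the `θ i` are linearly independent and in
  -- particular distinct.
  · exact (linearIndependent_of_hasLeadingTerm hβ hli₁ hli₂ hπ (fun i => (hadm i).2)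
      hθlead).injective
  · refine (Submodule.span_le (p := Subalgebra.toSubmodule (MvPolynomial.aeval θ).range)).mpr ?_
      (hspan f hf)
    rintro _ ⟨K, rfl⟩
    exact mon_mem_range_aeval θ K
  · exact fun K _ => coe_mem_formalInvariants.mpr (hθinv K)
  · refine linearIndependent_of_hasLeadingTerm hβ hli₁ hli₂
      (v := fun K : boxProduct X₁ Z₁ X₂ Z₂ α β A₁ A₂ π => ∑ i, (K : Fin t →₀ ℕ) i • π i)
      ?_ ?_ (fun K => hlead K)
    -- Distinct exponents in the box product have distinct leading vectors, since a vector has only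
    -- one greedy factorization.
    · rintro ⟨K, hK⟩ ⟨L, hL⟩ hKL
      obtain ⟨v, -, hvK⟩ := mem_boxProduct.mp hK
      obtain ⟨w, -, hwL⟩ := mem_boxProduct.mp hL
      obtain rfl : v = w := by
        rw [hvK.complete, hwL.complete]
        exact hKL
      exact Subtype.ext (hvK.unique hwL)
    · rintro ⟨K, hK⟩
      obtain ⟨v, hv, hvK⟩ := mem_boxProduct.mp hK
      have := hv.2
      rwa [hvK.complete] at this
  · choose d hd using fun i => (hθ i).homogeneous
    exact fun f hf => exists_isFormalSum
      (e := fun K : boxProduct X₁ Z₁ X₂ Z₂ α β A₁ A₂ π => mon θ (K : Fin t →₀ ℕ))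
      (fun K => mon_isHomogeneous hd K) hspan hf
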